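/- Let $V$ be Thompson's group $V$ acting on $[0,1)$: the group of all bijections $g$ of $[0,1)$ for which there are finite rooted planar binary trees $s,t$ with the same number of leaves and a bijection $\sigma$ from the leaves of $s$ to the leaves of $t$ such that $g$ maps the standard dyadic interval of each leaf $i$ of $s$ affinely and increasingly onto the standard dyadic interval of the leaf $\sigma(i)$ of $t$ (write $g=(t,\sigma,s)$). Let $F\subset T\subset V$ be Thompson's groups $F$ (the increasing elements of $V$) and $T$ (the elements of $V$ preserving the cyclic order of the circle $[0,1)=\mathbf R/\mathbf Z$). For a complex Hilbert space $\mathfrak H$ and an isometry $R:\mathfrak H\to\mathfrak H\otimes\mathfrak H$, let $\Phi_R(p):\mathfrak H^{\otimes n}\to\mathfrak H^{\otimes k}$ be the isometry attached to a binary planar forest $p$ with $n$ roots and $k$ leaves, obtained by applying $R$ at every vertex of $p$. Let $\mathscr H_R$ be the Hilbert space completion of the inductive limit of the spaces of pairs $(t,\xi)$, where $t$ is a tree with $n$ leaves and $\xi\in\mathfrak H^{\otimes n}$, under the identifications $(t,\xi)\sim(p\circ t,\Phi_R(p)\xi)$, with inner product $\langle (t,\xi),(t,\eta)\rangle=\langle\xi,\eta\rangle$.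 Jones' construction gives a unitary representation $\pi_R:V\to\mathcal U(\mathscr H_R)$ with $\pi_R(g)(s,\xi)=(t,\theta_\sigma\xi)$ for $g=(t,\sigma,s)$, where $\theta_\sigma$ permutes the tensor factors according to $\sigma$. Take $\mathfrak H=\ell^2(\mathbf Z)$, let $u$ be the shift operator $(u\xi)(n)=\xi(n-1)$ and, for $m\ge 1$, let $h(m)=2m8^m$ and let $\zeta_m\in\ell^2(\mathbf Z)$ be the characteristic function of $\{1,\dots,h(m)\}$ divided by $\sqrt{h(m)}$. Let $R_m(\xi)=u\xi\otimes\zeta_m$, let $(\pi,\mathscr H)=\bigoplus_{m\ge1}(\pi_{R_m},\mathscr H_{R_m})$, and let $\xi_m\in\mathscr H$ be the vector whose $m$-th component is $(t_m,\zeta_m^{\otimes 2^m})$, with $t_m$ the complete binary tree with $2^m$ leaves, and whose other components are $0$. Then: 1. $(\xi_m)_{m\ge1}$ is an almost $V$-invariant sequence of unit vectors: $\|\xi_m\|=1$ for all $m$ and $\|\pi(g)\xi_m-\xi_m\|\to0$ as $m\to\infty$ for every $g\in V$. 2. $\pi$ has no nonzero $[F,F]$-invariant vector. 3. No group $G$ with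 $[F,F]\subset G\subset V$ has Kazhdan's property (T), where a discrete group $G$ has property (T) if every unitary representation of $G$ that has almost invariant unit vectors (for every finite $Q\subset G$ and $\varepsilon>0$ there is a unit vector moved by less than $\varepsilon$ by every element of $Q$) has a nonzero invariant vector. In particular $[F,F]\subset T$, and $T$ does not have property (T). -/

import Mathlib

open scoped TensorProduct

noncomputable section

namespace JonesThompson

section TensorInner

variable {ι κ H : Type*} [Fintype ι] [Fintype κ] [NormedAddCommGroup H] [InnerProductSpace ℂ H]

/-- The functional `⊗ xᵢ ↦ ∏ ⟪yᵢ, xᵢ⟫`. -/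
def tensorFunctional (y : ι → H) : (⨂[ℂ] _ : ι, H) →ₗ[ℂ] ℂ :=
  PiTensorProduct.lift
    ((MultilinearMap.mkPiAlgebra ℂ ι ℂ).compLinearMap fun i => innerₛₗ ℂ (y i))

theorem tensorFunctional_tprod (y x : ι → H) :
    tensorFunctional y (PiTensorProduct.tprod ℂ x) = ∏ i, inner ℂ (y i) (x i) := by
  simp [tensorFunctional]

/-- The sesquilinear form, linear in the first argument here. -/
def tensorForm : (⨂[ℂ] _ : ι, H) →ₗ[ℂ] ((⨂[ℂ] _ : ι, H) →ₗ⋆[ℂ] ℂ) :=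
  PiTensorProduct.lift
    { toFun := fun y =>
        { toFun := fun x => starRingEnd ℂ (tensorFunctional y x)
          map_add' := fun a b => by simp
          map_smul' := fun c a => by simp }
      map_update_add' := by
        intro _ y i a b
        ext x
        induction x using PiTensorProduct.induction_on with
        | smul_tprod r f =>
          have := (((MultilinearMap.mkPiAlgebra ℂ ι ℂ).compLinearMap
            fun i => innerₛₗ ℂ (f i))).map_update_add y i a b
          simp only [MultilinearMap.compLinearMap_apply, MultilinearMap.mkPiAlgebra_apply,
            innerₛₗ_apply_apply] at this
          simp [tensorFunctional_tprod, map_prod, this]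
        | add u v hu hv => simp_all; ring
      map_update_smul' := by
        intro _ y i c a
        ext x
        induction x using PiTensorProduct.induction_on with
        | smul_tprod r f =>
          have := (((MultilinearMap.mkPiAlgebra ℂ ι ℂ).compLinearMap
            fun i => innerₛₗ ℂ (f i))).map_update_smul y i c a
          simp only [MultilinearMap.compLinearMap_apply, MultilinearMap.mkPiAlgebra_apply,
            innerₛₗ_apply_apply, smul_eq_mul] at this
          simp [tensorFunctional_tprod, map_prod, this]
        | add u v hu hv => simp_all; ring }

/-- The inner product on the algebraic tensor power, determined by
`⟪⊗ xᵢ, ⊗ yᵢ⟫ = ∏ ⟪xᵢ, yᵢ⟫` (conjugate-linear in the first variable). -/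
def tensorInner (x y : ⨂[ℂ] _ : ι, H) : ℂ := tensorForm y x

theorem tensorInner_tprod (x y : ι → H) :
    tensorInner (PiTensorProduct.tprod ℂ x) (PiTensorProduct.tprod ℂ y) =
      ∏ i, inner ℂ (x i) (y i) := by
  simp [tensorInner, tensorForm, tensorFunctional_tprod, map_prod]

theorem tensorInner_add_left (x y z : ⨂[ℂ] _ : ι, H) :
    tensorInner (x + y) z = tensorInner x z + tensorInner y z := by simp [tensorInner]

theorem tensorInner_add_right (x y z : ⨂[ℂ] _ : ι, H) :
    tensorInner x (y + z) = tensorInner x y + tensorInner x z := by simp [tensorInner]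

theorem tensorInner_smul_left (c : ℂ) (x y : ⨂[ℂ] _ : ι, H) :
    tensorInner (c • x) y = starRingEnd ℂ c * tensorInner x y := by simp [tensorInner]

theorem tensorInner_smul_right (c : ℂ) (x y : ⨂[ℂ] _ : ι, H) :
    tensorInner x (c • y) = c * tensorInner x y := by simp [tensorInner]

theorem tensorInner_sum_left {α : Type*} (s : Finset α) (f : α → ⨂[ℂ] _ : ι, H)
    (y : ⨂[ℂ] _ : ι, H) : tensorInner (∑ a ∈ s, f a) y = ∑ a ∈ s, tensorInner (f a) y := by
  simp [tensorInner]

theorem tensorInner_sum_right {α : Type*} (s : Finset α) (f : α → ⨂[ℂ] _ : ι, H)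
    (x : ⨂[ℂ] _ : ι, H) : tensorInner x (∑ a ∈ s, f a) = ∑ a ∈ s, tensorInner x (f a) := by
  simp [tensorInner]

theorem tensorInner_conj (x y : ⨂[ℂ] _ : ι, H) :
    starRingEnd ℂ (tensorInner y x) = tensorInner x y := by
  induction x using PiTensorProduct.induction_on with
  | smul_tprod r f =>
    induction y using PiTensorProduct.induction_on with
    | smul_tprod s g =>
      simp [tensorInner_smul_left, tensorInner_smul_right, tensorInner_tprod, map_prod]; ring
    | add u v hu hv => simp [tensorInner_add_left, tensorInner_add_right, hu, hv]
  | add u v hu hv => simp [tensorInner_add_left, tensorInner_add_right, hu, hv]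

theorem exists_finite_mapIncl (x : ⨂[ℂ] _ : ι, H) :
    ∃ S : Submodule ℂ H, FiniteDimensional ℂ S ∧
      ∃ y, PiTensorProduct.mapIncl (fun _ : ι => S) y = x := by
  have mono : ∀ (S S' : Submodule ℂ H), S ≤ S' → ∀ y, ∃ y',
      PiTensorProduct.mapIncl (fun _ : ι => S') y' = PiTensorProduct.mapIncl (fun _ : ι => S) y := by
    intro S S' h y
    refine ⟨PiTensorProduct.map (fun _ => Submodule.inclusion h) y, ?_⟩
    induction y using PiTensorProduct.induction_on with
    | smul_tprod r f => simp [PiTensorProduct.mapIncl]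
    | add u v hu hv => rw [map_add, map_add, map_add, hu, hv]
  induction x using PiTensorProduct.induction_on with
  | smul_tprod r f =>
    refine ⟨Submodule.span ℂ (Set.range f), FiniteDimensional.span_of_finite ℂ (Set.finite_range f),
      r • PiTensorProduct.tprod ℂ fun i => ⟨f i, Submodule.subset_span ⟨i, rfl⟩⟩, ?_⟩
    simp [PiTensorProduct.mapIncl]
  | add u v hu hv =>
    obtain ⟨S, hS, y, rfl⟩ := hu
    obtain ⟨S', hS', y', rfl⟩ := hv
    obtain ⟨z, hz⟩ := mono S (S ⊔ S') le_sup_left y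
    obtain ⟨z', hz'⟩ := mono S' (S ⊔ S') le_sup_right y'
    exact ⟨S ⊔ S', inferInstance, z + z', by rw [map_add, hz, hz']⟩

theorem exists_tensorInner_self [DecidableEq ι] (x : ⨂[ℂ] _ : ι, H) :
    ∃ (n : ℕ) (c : (ι → Fin n) → ℂ) (e : (ι → Fin n) → ⨂[ℂ] _ : ι, H),
      x = ∑ p, c p • e p ∧ tensorInner x x = ((∑ p, ‖c p‖ ^ 2 : ℝ) : ℂ) := by
  classical
  obtain ⟨S, hS, y, rfl⟩ := exists_finite_mapIncl x
  let b := stdOrthonormalBasis ℂ S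
  let B := Basis.piTensorProduct (fun _ : ι => b.toBasis)
  have hx : PiTensorProduct.mapIncl (fun _ : ι => S) y =
      ∑ p, B.repr y p • PiTensorProduct.tprod ℂ (fun i => (b (p i) : H)) := by
    conv_lhs => rw [← B.sum_repr y]
    simp [B, PiTensorProduct.mapIncl, Basis.piTensorProduct_apply]
  refine ⟨_, fun p => B.repr y p, fun p => PiTensorProduct.tprod ℂ (fun i => (b (p i) : H)), hx, ?_⟩
  rw [hx]
  have key : ∀ p q : ι → Fin (Module.finrank ℂ S),
      ∏ i, inner ℂ ((b (p i) : S) : H) ((b (q i) : S) : H) = if p = q then (1 : ℂ) else 0 := by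
    intro p q
    have : ∀ i, inner ℂ ((b (p i) : S) : H) ((b (q i) : S) : H) =
        if p i = q i then (1 : ℂ) else 0 := fun i => by
      rw [← Submodule.coe_inner, OrthonormalBasis.inner_eq_ite]
    simp only [this, Finset.prod_ite_zero, Finset.prod_const_one, Finset.mem_univ, true_implies,
      funext_iff]
  simp only [tensorInner_sum_left, tensorInner_sum_right, tensorInner_smul_left,
    tensorInner_smul_right, tensorInner_tprod, key]
  simp [RCLike.mul_conj]

theorem tensorInner_self_nonneg (x : ⨂[ℂ] _ : ι, H) : 0 ≤ (tensorInner x x).re := by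
  classical
  obtain ⟨n, c, e, -, h⟩ := exists_tensorInner_self x
  rw [h, Complex.ofReal_re]
  positivity

theorem tensorInner_definite (x : ⨂[ℂ] _ : ι, H) (hx : tensorInner x x = 0) : x = 0 := by
  classical
  obtain ⟨n, c, e, h', h⟩ := exists_tensorInner_self x
  rw [h, Complex.ofReal_eq_zero, Finset.sum_eq_zero_iff_of_nonneg fun _ _ => sq_nonneg _] at hx
  rw [h']
  refine Finset.sum_eq_zero fun p hp => ?_
  have := hx p hp
  simp at this
  simp [this]

theorem tensorInner_reindex (e : ι ≃ κ) (x y : ⨂[ℂ] _ : ι, H) :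
    tensorInner (PiTensorProduct.reindex ℂ (fun _ => H) e x)
      (PiTensorProduct.reindex ℂ (fun _ => H) e y) = tensorInner x y := by
  induction x using PiTensorProduct.induction_on with
  | smul_tprod r f =>
    induction y using PiTensorProduct.induction_on with
    | smul_tprod s g =>
      simp only [map_smul, PiTensorProduct.reindex_tprod, tensorInner_smul_left,
        tensorInner_smul_right, tensorInner_tprod]
      rw [Equiv.prod_comp e.symm (fun i => inner ℂ (f i) (g i))]
    | add u v hu hv => simp only [map_add, tensorInner_add_right, hu, hv]
  | add u v hu hv => simp only [map_add, tensorInner_add_left, hu, hv]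

theorem tensorInner_tmul (a c : ⨂[ℂ] _ : ι, H) (b d : ⨂[ℂ] _ : κ, H) :
    tensorInner (PiTensorProduct.tmulEquiv ℂ H (a ⊗ₜ b)) (PiTensorProduct.tmulEquiv ℂ H (c ⊗ₜ d)) =
      tensorInner a c * tensorInner b d := by
  induction a using PiTensorProduct.induction_on with
  | smul_tprod r f =>
    induction b using PiTensorProduct.induction_on with
    | smul_tprod r' f' =>
      induction c using PiTensorProduct.induction_on with
      | smul_tprod s g =>
        induction d using PiTensorProduct.induction_on with
        | smul_tprod s' g' =>
          simp only [← TensorProduct.smul_tmul', TensorProduct.tmul_smul, map_smul,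
            tensorInner_smul_left, tensorInner_smul_right, tensorInner_tprod,
            PiTensorProduct.tmulEquiv_apply, Fintype.prod_sum_type, Sum.elim_inl, Sum.elim_inr]
          ring
        | add u v hu hv => simp only [TensorProduct.tmul_add, map_add, tensorInner_add_right, hu, hv, mul_add]
      | add u v hu hv => simp only [TensorProduct.add_tmul, map_add, tensorInner_add_right, hu, hv, add_mul]
    | add u v hu hv => simp only [TensorProduct.tmul_add, map_add, tensorInner_add_left, hu, hv, mul_add]
  | add u v hu hv => simp only [TensorProduct.add_tmul, map_add, tensorInner_add_left, hu, hv, add_mul]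

end TensorInner

/-! ### Binary trees -/

/-- Finite rooted planar binary trees. -/
inductive BTree : Type
  | leaf : BTree
  | node : BTree → BTree → BTree

/-- The leaves of a tree: those of `node l r` are the leaves of `l` followed by those of `r`. -/
def Leaves : BTree → Type
  | .leaf => Unit
  | .node l r => Leaves l ⊕ Leaves r

instance instFintypeLeaves : ∀ t, Fintype (Leaves t)
  | .leaf => inferInstanceAs (Fintype Unit)
  | .node l r =>
    letI := instFintypeLeaves l
    letI := instFintypeLeaves r
    inferInstanceAs (Fintype (Leaves l ⊕ Leaves r))

instance : Nonempty BTree := ⟨.leaf⟩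

namespace BTree

/-- `s.Le t`: the tree `t` is obtained from `s` by attaching a tree to each leaf of `s`,
that is, `t = p ∘ s` for a (then unique) forest `p`. -/
def Le : BTree → BTree → Prop
  | .leaf, _ => True
  | .node _ _, .leaf => False
  | .node l r, .node l' r' => Le l l' ∧ Le r r'

theorem Le.refl : ∀ t : BTree, Le t t
  | .leaf => trivial
  | .node l r => ⟨Le.refl l, Le.refl r⟩

theorem Le.trans : ∀ {s t u : BTree}, Le s t → Le t u → Le s u
  | .leaf, _, _, _, _ => trivial
  | .node _ _, .leaf, _, h, _ => h.elim
  | .node _ _, .node _ _, .leaf, _, h => h.elim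
  | .node _ _, .node _ _, .node _ _, h, h' => ⟨Le.trans h.1 h'.1, Le.trans h.2 h'.2⟩

instance : Preorder BTree where
  le := Le
  le_refl := Le.refl
  le_trans _ _ _ := Le.trans

/-- The smallest common refinement of two trees. -/
def join : BTree → BTree → BTree
  | .leaf, t => t
  | .node l r, .leaf => .node l r
  | .node l r, .node l' r' => .node (join l l') (join r r')

theorem le_join_left : ∀ s t : BTree, s ≤ join s t
  | .leaf, _ => trivial
  | .node l r, .leaf => Le.refl (.node l r)
  | .node l r, .node l' r' => ⟨le_join_left l l', le_join_left r r'⟩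

theorem le_join_right : ∀ s t : BTree, t ≤ join s t
  | .leaf, t => Le.refl t
  | .node _ _, .leaf => trivial
  | .node l r, .node l' r' => ⟨le_join_right l l', le_join_right r r'⟩

instance : IsDirectedOrder BTree :=
  ⟨fun s t => ⟨join s t, le_join_left s t, le_join_right s t⟩⟩

/-- The complete binary tree with `2 ^ n` leaves. -/
def complete : ℕ → BTree
  | 0 => .leaf
  | n + 1 => .node (complete n) (complete n)

end BTree

/-! ### The functor attached to an isometry `R` -/

section Functor

variable {H : Type*} [NormedAddCommGroup H] [InnerProductSpace ℂ H]

/-- The algebraic tensor power `H ^ ⊗ n`, with `n` the number of leaves of `t` and one factor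
for each leaf. -/
abbrev TensorPow (H : Type*) [NormedAddCommGroup H] [InnerProductSpace ℂ H] (t : BTree) :=
  ⨂[ℂ] _ : Leaves t, H

/-- Juxtaposition of tensors over the leaves of `l` and over the leaves of `r`. -/
def joinTensor (l r : BTree) : TensorPow H l ⊗[ℂ] TensorPow H r ≃ₗ[ℂ] TensorPow H (.node l r) :=
  PiTensorProduct.tmulEquiv (ι := Leaves l) (ι₂ := Leaves r) ℂ H

/-- `H ^ ⊗ 1 = H`. -/
def leafTensor : TensorPow H .leaf ≃ₗ[ℂ] H :=
  PiTensorProduct.subsingletonEquiv (ι := Unit) ()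

/-- `Φ(t) : H → H ^ ⊗ n` for a tree `t` with `n` leaves: apply `R` at every vertex of `t`. -/
def phiTree (R : H →ₗᵢ[ℂ] H ⊗[ℂ] H) : ∀ t : BTree, H →ₗ[ℂ] TensorPow H t
  | .leaf => leafTensor.symm.toLinearMap
  | .node l r =>
    (joinTensor l r).toLinearMap ∘ₗ TensorProduct.map (phiTree R l) (phiTree R r) ∘ₗ R.toLinearMap

/-- `Φ(p)`, for the forest `p` with `t = p ∘ s`. Since `p` is the juxtaposition of the
trees attached to the leaves of `s`, this is the tensor product over the leaves of `s` of the maps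
`Φ` of these trees. The value is irrelevant unless `s ≤ t`. -/
def phi (R : H →ₗᵢ[ℂ] H ⊗[ℂ] H) : ∀ s t : BTree, TensorPow H s →ₗ[ℂ] TensorPow H t
  | .leaf, t => phiTree R t ∘ₗ leafTensor.toLinearMap
  | .node _ _, .leaf => 0
  | .node l r, .node l' r' =>
    (joinTensor l' r').toLinearMap ∘ₗ TensorProduct.map (phi R l l') (phi R r r') ∘ₗ
      (joinTensor l r).symm.toLinearMap

variable (R : H →ₗᵢ[ℂ] H ⊗[ℂ] H)

theorem phi_self : ∀ t : BTree, phi R t t = LinearMap.id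
  | .leaf => by ext1; simp [phi, phiTree]
  | .node l r => by
    rw [phi, phi_self l, phi_self r, TensorProduct.map_id]
    ext1; simp

theorem phi_phiTree : ∀ {s t : BTree}, s ≤ t → phi R s t ∘ₗ phiTree R s = phiTree R t
  | .leaf, t, _ => by
    ext1 x; simp [phi, phiTree]
  | .node _ _, .leaf, h => h.elim
  | .node l r, .node l' r', h => by
    have h1 := phi_phiTree (s := l) (t := l') h.1
    have h2 := phi_phiTree (s := r) (t := r') h.2
    ext1 x
    simp only [phi, phiTree, LinearMap.comp_apply, LinearEquiv.coe_coe,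
      LinearEquiv.symm_apply_apply]
    rw [← h1, ← h2, TensorProduct.map_comp, LinearMap.comp_apply]

theorem phi_comp : ∀ {s t u : BTree}, s ≤ t → t ≤ u → phi R t u ∘ₗ phi R s t = phi R s u
  | .leaf, t, u, _, h => by
    rw [phi, phi, ← LinearMap.comp_assoc, phi_phiTree R h]
  | .node _ _, .leaf, _, h, _ => h.elim
  | .node _ _, .node _ _, .leaf, _, h => h.elim
  | .node l r, .node l' r', .node l'' r'', h, h' => by
    have h1 := phi_comp h.1 h'.1
    have h2 := phi_comp h.2 h'.2
    refine LinearMap.ext fun x => ?_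
    simp only [phi, LinearMap.comp_apply, LinearEquiv.coe_coe, LinearEquiv.symm_apply_apply]
    rw [← h1, ← h2, TensorProduct.map_comp, LinearMap.comp_apply]

theorem tensorInner_joinTensor {l r : BTree} (a c : TensorPow H l) (b d : TensorPow H r) :
    tensorInner (joinTensor l r (a ⊗ₜ b)) (joinTensor l r (c ⊗ₜ d)) =
      tensorInner a c * tensorInner b d :=
  tensorInner_tmul a c b d

theorem tensorInner_leafTensor_symm (x y : H) :
    tensorInner (leafTensor.symm x) (leafTensor.symm y) = inner ℂ x y := by
  have : ∀ z : H, leafTensor.symm z = PiTensorProduct.tprod ℂ fun _ : Leaves .leaf => z := fun z =>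
    PiTensorProduct.subsingletonEquiv_symm_apply' (ι := Unit) () z
  rw [this, this, tensorInner_tprod]
  exact Fintype.prod_unique (ι := Unit) _

theorem tensorInner_phiTree : ∀ (t : BTree) (x y : H),
    tensorInner (phiTree R t x) (phiTree R t y) = inner ℂ x y
  | .leaf, x, y => tensorInner_leafTensor_symm x y
  | .node l r, x, y => by
    have key : ∀ z w : H ⊗[ℂ] H,
        tensorInner (joinTensor l r (TensorProduct.map (phiTree R l) (phiTree R r) z))
          (joinTensor l r (TensorProduct.map (phiTree R l) (phiTree R r) w)) = inner ℂ z w := by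
      intro z w
      induction z with
      | zero => simp [tensorInner]
      | add a b ha hb => simp only [map_add, tensorInner_add_left, inner_add_left, ha, hb]
      | tmul a b =>
        induction w with
        | zero => simp [tensorInner]
        | add a b ha hb => simp only [map_add, tensorInner_add_right, inner_add_right, ha, hb]
        | tmul c d =>
          rw [TensorProduct.map_tmul, TensorProduct.map_tmul, tensorInner_joinTensor,
            tensorInner_phiTree l, tensorInner_phiTree r, TensorProduct.inner_tmul]
    simp only [phiTree, LinearMap.comp_apply, LinearEquiv.coe_coe]
    rw [key]
    exact R.inner_map_map x y

theorem tensorInner_phi : ∀ {s t : BTree}, s ≤ t → ∀ x y : TensorPow H s,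
    tensorInner (phi R s t x) (phi R s t y) = tensorInner x y
  | .leaf, t, _, x, y => by
    obtain ⟨x, rfl⟩ := leafTensor.symm.surjective x
    obtain ⟨y, rfl⟩ := leafTensor.symm.surjective y
    simp [phi, tensorInner_phiTree, tensorInner_leafTensor_symm]
  | .node _ _, .leaf, h, _, _ => h.elim
  | .node l r, .node l' r', h, x, y => by
    obtain ⟨x, rfl⟩ := (joinTensor l r).surjective x
    obtain ⟨y, rfl⟩ := (joinTensor l r).surjective y
    simp only [phi, LinearMap.comp_apply, LinearEquiv.coe_coe, LinearEquiv.symm_apply_apply]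
    induction x with
    | zero => simp [tensorInner]
    | add a b ha hb => simp only [map_add, tensorInner_add_left, ha, hb]
    | tmul a b =>
      induction y with
      | zero => simp [tensorInner]
      | add a b ha hb => simp only [map_add, tensorInner_add_right, ha, hb]
      | tmul c d =>
        rw [TensorProduct.map_tmul, TensorProduct.map_tmul, tensorInner_joinTensor,
          tensorInner_joinTensor, tensorInner_phi h.1, tensorInner_phi h.2]

instance instDirectedSystem :
    DirectedSystem (TensorPow H) (fun s t (_ : s ≤ t) => phi R s t) where
  map_self s x := by rw [phi_self]; rfl
  map_map s t u h h' x := by rw [← phi_comp R h h']; rfl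

/-! ### The Hilbert space -/

/-- The inductive limit of the spaces `H_t = H ^ ⊗ n` along the maps `Φ(p) : H_t → H_{p ∘ t}`: the
quotient of the set of pairs `(t, ξ)` by the relation generated by `(t, ξ) ∼ (p ∘ t, Φ(p) ξ)`. -/
def JonesPreSpace : Type _ :=
  DirectLimit (TensorPow H) (fun s t (_ : s ≤ t) => phi R s t)

instance : AddCommGroup (JonesPreSpace R) :=
  inferInstanceAs (AddCommGroup (DirectLimit (TensorPow H) (fun s t (_ : s ≤ t) => phi R s t)))

instance : Module ℂ (JonesPreSpace R) :=
  inferInstanceAs (Module ℂ (DirectLimit (TensorPow H) (fun s t (_ : s ≤ t) => phi R s t)))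

/-- The class of `(t, ξ)`. -/
def preClass (t : BTree) : TensorPow H t →ₗ[ℂ] JonesPreSpace R :=
  DirectLimit.Module.of ℂ BTree (TensorPow H) (fun s t (_ : s ≤ t) => phi R s t) t

theorem preClass_phi {s t : BTree} (h : s ≤ t) (x : TensorPow H s) :
    preClass R t (phi R s t x) = preClass R s x :=
  DirectLimit.Module.of_f (hij := h)

theorem exists_preClass (x : JonesPreSpace R) : ∃ t ξ, x = preClass R t ξ :=
  DirectLimit.exists_eq_mk _ x

theorem exists_preClass₂ (x y : JonesPreSpace R) :
    ∃ t ξ η, x = preClass R t ξ ∧ y = preClass R t η :=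
  DirectLimit.exists_eq_mk₂ _ x y

theorem preClass_eq {s t : BTree} {x : TensorPow H s} {y : TensorPow H t}
    (h : preClass R s x = preClass R t y) :
    ∃ u, s ≤ u ∧ t ≤ u ∧ phi R s u x = phi R t u y := by
  obtain ⟨u, hs, ht, e⟩ := Quotient.exact h
  exact ⟨u, hs, ht, e⟩

/-- The inner product `⟪(t, ξ), (t, η)⟫ = ⟪ξ, η⟫`. -/
def preInner : JonesPreSpace R → JonesPreSpace R → ℂ :=
  DirectLimit.lift₂ (fun s t (_ : s ≤ t) => phi R s t) (fun s t (_ : s ≤ t) => phi R s t)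
    (fun _ x y => tensorInner x y) fun _ _ h x y => (tensorInner_phi R h x y).symm

theorem preInner_preClass (t : BTree) (x y : TensorPow H t) :
    preInner R (preClass R t x) (preClass R t y) = tensorInner x y :=
  DirectLimit.lift₂_def ..

/-- The pre-Hilbert structure of the inductive limit. -/
@[reducible]
def jonesCore : InnerProductSpace.Core ℂ (JonesPreSpace R) where
  inner := preInner R
  conj_inner_symm x y := by
    obtain ⟨t, ξ, η, rfl, rfl⟩ := exists_preClass₂ R x y
    simp only [preInner_preClass, tensorInner_conj]
  re_inner_nonneg x := by
    obtain ⟨t, ξ, rfl⟩ := exists_preClass R x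
    simp only [preInner_preClass]
    exact tensorInner_self_nonneg ξ
  add_left x y z := by
    obtain ⟨t, ξ, η, rfl, rfl⟩ := exists_preClass₂ R x y
    obtain ⟨s, ζ, rfl⟩ := exists_preClass R z
    rw [← preClass_phi R (BTree.le_join_left t s), ← preClass_phi R (BTree.le_join_left t s) η,
      ← preClass_phi R (BTree.le_join_right t s), ← map_add]
    simp only [preInner_preClass, tensorInner_add_left]
  smul_left x y c := by
    obtain ⟨t, ξ, η, rfl, rfl⟩ := exists_preClass₂ R x y
    rw [← map_smul]
    simp only [preInner_preClass, tensorInner_smul_left]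
  definite x h := by
    obtain ⟨t, ξ, rfl⟩ := exists_preClass R x
    rw [preInner_preClass] at h
    rw [tensorInner_definite ξ h, map_zero]

instance : NormedAddCommGroup (JonesPreSpace R) := (jonesCore R).toNormedAddCommGroup

instance : InnerProductSpace ℂ (JonesPreSpace R) := .ofCore (jonesCore R).toCore

theorem inner_preClass (t : BTree) (x y : TensorPow H t) :
    inner ℂ (preClass R t x) (preClass R t y) = tensorInner x y :=
  preInner_preClass R t x y

/-- The Hilbert space of the Jones representation: the completion of the inductive limit. -/
abbrev JonesSpace : Type _ := UniformSpace.Completion (JonesPreSpace R)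

/-- The vector `(t, ξ)` of the Hilbert space, for a tree `t` with `n` leaves and
`ξ ∈ H ^ ⊗ n`. -/
def fraction (t : BTree) (ξ : TensorPow H t) : JonesSpace R := (preClass R t ξ : JonesPreSpace R)

end Functor

/-! ### Thompson's groups -/

/-- The half-open unit interval `[0, 1)`. -/
abbrev UnitIco := Set.Ico (0 : ℝ) 1

/-- `x ↦ x / 2`. -/
def lowerHalf (x : UnitIco) : UnitIco :=
  ⟨x / 2, by have := x.2.1; linarith, by have := x.2.2; linarith⟩

/-- `x ↦ (x + 1) / 2`. -/
def upperHalf (x : UnitIco) : UnitIco :=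
  ⟨(x + 1) / 2, by have := x.2.1; linarith, by have := x.2.2; linarith⟩

/-- The increasing affine bijection of `[0, 1)` onto the standard dyadic interval `Iᵢ` attached to
the leaf `i` of `t`: the interval `[0, 1)` is attached to the root, and whenever `[a, b)` is
attached to a vertex, its left and right halves are attached to the two children. The intervals
of the leaves form the standard dyadic partition associated to `t`. -/
def chart : ∀ t : BTree, Leaves t → UnitIco → UnitIco
  | .leaf, _, x => x
  | .node l _, .inl i, x => lowerHalf (chart l i x)
  | .node _ r, .inr i, x => upperHalf (chart r i x)

/-- The bijection `g` of `[0, 1)` is given by the pair of trees `s`, `t` and the bijection `σ`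
between their leaves: it maps the interval of the leaf `i` of `s` affinely and increasingly onto the
interval of the leaf `σ i` of `t`. -/
def Represents (g : Equiv.Perm UnitIco) (s t : BTree) (σ : Leaves s ≃ Leaves t) : Prop :=
  ∀ i x, g (chart s i x) = chart t (σ i) x

theorem lowerHalf_injective : Function.Injective lowerHalf := fun x y h => by
  have := congrArg Subtype.val h
  simp only [lowerHalf] at this
  exact Subtype.ext (by linarith)

theorem upperHalf_injective : Function.Injective upperHalf := fun x y h => by
  have := congrArg Subtype.val h
  simp only [upperHalf] at this
  exact Subtype.ext (by linarith)

theorem lowerHalf_ne_upperHalf (x y : UnitIco) : lowerHalf x ≠ upperHalf y := fun h => by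
  have := congrArg Subtype.val h
  simp only [lowerHalf, upperHalf] at this
  have := x.2.2
  have := y.2.1
  linarith

theorem chart_injective : ∀ (t : BTree) (i j : Leaves t) (x y : UnitIco),
    chart t i x = chart t j y → i = j ∧ x = y
  | .leaf, _, _, _, _, h => ⟨rfl, h⟩
  | .node l _, .inl i, .inl j, x, y, h => by
    obtain ⟨rfl, h'⟩ := chart_injective l i j x y (lowerHalf_injective h)
    exact ⟨rfl, h'⟩
  | .node _ r, .inr i, .inr j, x, y, h => by
    obtain ⟨rfl, h'⟩ := chart_injective r i j x y (upperHalf_injective h)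
    exact ⟨rfl, h'⟩
  | .node _ _, .inl _, .inr _, _, _, h => (lowerHalf_ne_upperHalf _ _ h).elim
  | .node _ _, .inr _, .inl _, _, _, h => (lowerHalf_ne_upperHalf _ _ h.symm).elim

theorem chart_surjective : ∀ (t : BTree) (x : UnitIco), ∃ i y, chart t i y = x
  | .leaf, x => ⟨(), x, rfl⟩
  | .node l r, x => by
    by_cases h : (x : ℝ) < 1 / 2
    · obtain ⟨i, y, hy⟩ := chart_surjective l ⟨2 * x, by have := x.2.1; linarith, by linarith⟩
      refine ⟨.inl i, y, ?_⟩
      rw [chart, hy]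
      exact Subtype.ext (by simp [lowerHalf])
    · obtain ⟨i, y, hy⟩ := chart_surjective r
        ⟨2 * x - 1, by linarith, by have := x.2.2; linarith⟩
      refine ⟨.inr i, y, ?_⟩
      rw [chart, hy]
      exact Subtype.ext (by simp [upperHalf])

theorem BTree.eq_of_chart : ∀ (t u : BTree), (∀ i : Leaves t, ∃ j : Leaves u, chart t i = chart u j) →
    t = u
  | .leaf, .leaf, _ => rfl
  | .leaf, .node l r, h => by
    exfalso
    obtain ⟨j, hj⟩ := h ()
    obtain j | j := j
    · exact lowerHalf_ne_upperHalf _ _ (congrFun hj (upperHalf ⟨0, by simp⟩)).symm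
    · exact lowerHalf_ne_upperHalf _ _ (congrFun hj (lowerHalf ⟨0, by simp⟩))
  | .node l r, .leaf, h => by
    exfalso
    obtain ⟨i⟩ : Nonempty (Leaves l) := let ⟨i, _⟩ := chart_surjective l ⟨0, by simp⟩; ⟨i⟩
    obtain ⟨j, hj⟩ := h (.inl i)
    exact lowerHalf_ne_upperHalf _ _ (congrFun hj (upperHalf ⟨0, by simp⟩))
  | .node l r, .node l' r', h => by
    have h1 : l = l' := BTree.eq_of_chart l l' fun i => by
      obtain ⟨j | j, hj⟩ := h (.inl i)
      · exact ⟨j, funext fun x => lowerHalf_injective (congrFun hj x)⟩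
      · exact (lowerHalf_ne_upperHalf _ _ (congrFun hj ⟨0, by simp⟩)).elim
    have h2 : r = r' := BTree.eq_of_chart r r' fun i => by
      obtain ⟨j | j, hj⟩ := h (.inr i)
      · exact (lowerHalf_ne_upperHalf _ _ (congrFun hj ⟨0, by simp⟩).symm).elim
      · exact ⟨j, funext fun x => upperHalf_injective (congrFun hj x)⟩
    rw [h1, h2]

theorem Represents.unique {g : Equiv.Perm UnitIco} {s t u : BTree} {σ : Leaves s ≃ Leaves t}
    {τ : Leaves s ≃ Leaves u} (h : Represents g s t σ) (h' : Represents g s u τ) :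
    ∃ e : t = u, e ▸ σ = τ := by
  have key : ∀ i, chart t (σ i) = chart u (τ i) := fun i => funext fun x => by rw [← h, ← h']
  have e : t = u := BTree.eq_of_chart t u fun i => ⟨τ (σ.symm i), by rw [← key]; simp⟩
  subst e
  exact ⟨rfl, Equiv.ext fun i =>
    (chart_injective _ _ _ ⟨0, by simp⟩ ⟨0, by simp⟩ (congrFun (key i) _)).1⟩

theorem Represents.refl (s : BTree) : Represents 1 s s (Equiv.refl _) := fun _ _ => rfl

theorem Represents.inv {g : Equiv.Perm UnitIco} {s t : BTree} {σ : Leaves s ≃ Leaves t}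
    (h : Represents g s t σ) : Represents g⁻¹ t s σ.symm := fun i x => by
  rw [Equiv.Perm.inv_eq_iff_eq, h, Equiv.apply_symm_apply]

theorem Represents.mul {g h : Equiv.Perm UnitIco} {s t u : BTree} {σ : Leaves s ≃ Leaves t}
    {τ : Leaves t ≃ Leaves u} (hg : Represents g t u τ) (hh : Represents h s t σ) :
    Represents (g * h) s u (σ.trans τ) := fun i x => by
  rw [Equiv.Perm.mul_apply, hh, hg, Equiv.trans_apply]

/-! #### Attaching trees to the leaves of a tree -/

namespace BTree

/-- Attach the tree `p i` to the leaf `i` of `t`, for every `i`. -/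
def graft : ∀ t : BTree, (Leaves t → BTree) → BTree
  | .leaf, p => p ()
  | .node l r, p => .node (graft l fun i => p (.inl i)) (graft r fun i => p (.inr i))

/-- The leaves of `graft t p` are pairs of a leaf `i` of `t` and a leaf of `p i`. -/
def graftLeaves : ∀ (t : BTree) (p : Leaves t → BTree),
    (Σ i, Leaves (p i)) ≃ Leaves (graft t p)
  | .leaf, p => Equiv.uniqueSigma (α := Unit) fun i => Leaves (p i)
  | .node l r, p =>
    (Equiv.sumSigmaDistrib (α := Leaves l) (β := Leaves r) fun i => Leaves (p i)).trans
      ((graftLeaves l fun i => p (.inl i)).sumCongr (graftLeaves r fun i => p (.inr i)))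

theorem chart_graft : ∀ (t : BTree) (p : Leaves t → BTree) (i : Leaves t) (j : Leaves (p i))
    (x : UnitIco), chart (graft t p) (graftLeaves t p ⟨i, j⟩) x = chart t i (chart (p i) j x)
  | .leaf, _, _, _, _ => rfl
  | .node l _, p, .inl i, j, x => congrArg lowerHalf (chart_graft l (fun i => p (.inl i)) i j x)
  | .node _ r, p, .inr i, j, x => congrArg upperHalf (chart_graft r (fun i => p (.inr i)) i j x)

theorem le_graft : ∀ (t : BTree) (p : Leaves t → BTree), t ≤ graft t p
  | .leaf, _ => trivial
  | .node l r, p => ⟨le_graft l fun i => p (.inl i), le_graft r fun i => p (.inr i)⟩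

theorem exists_graft : ∀ {s t : BTree}, s ≤ t → ∃ p, t = graft s p
  | .leaf, t, _ => ⟨fun _ => t, rfl⟩
  | .node _ _, .leaf, h => h.elim
  | .node l r, .node l' r', h => by
    obtain ⟨p, rfl⟩ := exists_graft (s := l) (t := l') h.1
    obtain ⟨q, rfl⟩ := exists_graft (s := r) (t := r') h.2
    exact ⟨fun i => Sum.elim p q i, rfl⟩

end BTree

section

variable {H : Type*} [NormedAddCommGroup H] [InnerProductSpace ℂ H] (R : H →ₗᵢ[ℂ] H ⊗[ℂ] H)

theorem exists_sum_tprod (t : BTree) (x : TensorPow H t) :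
    ∃ (n : ℕ) (f : Fin n → Leaves t → H), x = ∑ k, PiTensorProduct.tprod ℂ (f k) := by
  classical
  induction x using PiTensorProduct.induction_on with
  | smul_tprod r f =>
    obtain ⟨i⟩ : Nonempty (Leaves t) := let ⟨i, _⟩ := chart_surjective t ⟨0, by simp⟩; ⟨i⟩
    refine ⟨1, fun _ => Function.update f i (r • f i), ?_⟩
    simp
  | add u v hu hv =>
    obtain ⟨n, f, rfl⟩ := hu
    obtain ⟨m, g, rfl⟩ := hv
    exact ⟨n + m, Fin.append f g, by simp [Fin.sum_univ_add]⟩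

/-- Formula for `Φ(p)` on elementary tensors, the values of `Φ` on the trees of `p` being expanded
as sums of elementary tensors. -/
theorem phi_graft_tprod : ∀ (t : BTree) (p : Leaves t → BTree) (ξ : Leaves t → H)
    (n : Leaves t → ℕ) (f : ∀ i, Fin (n i) → Leaves (p i) → H),
    (∀ i, phiTree R (p i) (ξ i) = ∑ k, PiTensorProduct.tprod ℂ (f i k)) →
    ∀ _ : DecidableEq (Leaves t),
    phi R t (BTree.graft t p) (PiTensorProduct.tprod ℂ ξ) =
      ∑ k : (∀ i, Fin (n i)), PiTensorProduct.tprod ℂ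
        fun a => f ((BTree.graftLeaves t p).symm a).1 (k ((BTree.graftLeaves t p).symm a).1)
          ((BTree.graftLeaves t p).symm a).2
  | .leaf, p, ξ, n, f, hf, _ => by
    let _ : Unique (Leaves .leaf) := inferInstanceAs (Unique Unit)
    have h0 : phi R .leaf (BTree.graft .leaf p) (PiTensorProduct.tprod ℂ ξ) =
        phiTree R (p ()) (ξ ()) :=
      congrArg (phiTree R (p ()))
        (PiTensorProduct.subsingletonEquiv_apply_tprod (ι := Unit) () ξ)
    rw [h0]
    refine (hf ()).trans ?_
    exact Fintype.sum_equiv (Equiv.piUnique (α := Leaves .leaf) fun i => Fin (n i)).symm _ _ fun k => rfl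
  | .node l r, p, ξ, n, f, hf, _ => by
    classical
    have h1 := phi_graft_tprod l (fun i => p (.inl i)) (fun i => ξ (.inl i)) (fun i => n (.inl i))
      (fun i => f (.inl i)) (fun i => hf (.inl i)) (Classical.decEq _)
    have h2 := phi_graft_tprod r (fun i => p (.inr i)) (fun i => ξ (.inr i)) (fun i => n (.inr i))
      (fun i => f (.inr i)) (fun i => hf (.inr i)) (Classical.decEq _)
    have h0 : (joinTensor l r).symm (PiTensorProduct.tprod ℂ ξ) =
        PiTensorProduct.tprod ℂ (fun i => ξ (.inl i)) ⊗ₜ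
          PiTensorProduct.tprod ℂ (fun i => ξ (.inr i)) :=
      PiTensorProduct.tmulEquiv_symm_apply (ι := Leaves l) (ι₂ := Leaves r) ℂ H ξ
    refine (congrArg (fun z => joinTensor (BTree.graft l fun i => p (.inl i))
      (BTree.graft r fun i => p (.inr i)) (TensorProduct.map (phi R l _) (phi R r _) z)) h0).trans ?_
    rw [TensorProduct.map_tmul, h1, h2, TensorProduct.sum_tmul]
    simp only [TensorProduct.tmul_sum, map_sum]
    rw [← Fintype.sum_prod_type']
    let e : ((∀ i : Leaves l, Fin (n (.inl i))) × (∀ i : Leaves r, Fin (n (.inr i)))) ≃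
        (∀ i : Leaves (.node l r), Fin (n i)) :=
      (Equiv.sumPiEquivProdPi (ι := Leaves l) (ι' := Leaves r) fun i => Fin (n i)).symm
    refine Eq.trans ?_ (Equiv.sum_comp e _)
    refine Finset.sum_congr rfl fun k _ => ?_
    refine (PiTensorProduct.tmulEquiv_apply ℂ H _ _).trans ?_
    congr 1
    funext a
    obtain a | a := a <;> rfl

/-- The bijection between leaves obtained by attaching the same trees to corresponding leaves. -/
def graftEquiv {s t : BTree} (σ : Leaves s ≃ Leaves t) (q : Leaves t → BTree) :
    Leaves (BTree.graft s fun i => q (σ i)) ≃ Leaves (BTree.graft t q) :=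
  ((BTree.graftLeaves s fun i => q (σ i)).symm.trans
    (Equiv.sigmaCongrLeft (β := fun j => Leaves (q j)) σ)).trans (BTree.graftLeaves t q)

theorem graftEquiv_apply {s t : BTree} (σ : Leaves s ≃ Leaves t) (q : Leaves t → BTree)
    (i : Leaves s) (j : Leaves (q (σ i))) :
    graftEquiv σ q (BTree.graftLeaves s (fun i => q (σ i)) ⟨i, j⟩) =
      BTree.graftLeaves t q ⟨σ i, j⟩ := by
  simp [graftEquiv]

theorem Represents.graft {g : Equiv.Perm UnitIco} {s t : BTree} {σ : Leaves s ≃ Leaves t}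
    (h : Represents g s t σ) (q : Leaves t → BTree) :
    Represents g (BTree.graft s fun i => q (σ i)) (BTree.graft t q) (graftEquiv σ q) := by
  intro a x
  obtain ⟨⟨i, j⟩, rfl⟩ := (BTree.graftLeaves s fun i => q (σ i)).surjective a
  rw [graftEquiv_apply, BTree.chart_graft, BTree.chart_graft, h]

theorem phi_reindex {s t : BTree} (σ : Leaves s ≃ Leaves t) (q : Leaves t → BTree)
    (x : TensorPow H s) :
    phi R t (BTree.graft t q) (PiTensorProduct.reindex ℂ (fun _ => H) σ x) =
      PiTensorProduct.reindex ℂ (fun _ => H) (graftEquiv σ q)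
        (phi R s (BTree.graft s fun i => q (σ i)) x) := by
  classical
  induction x using PiTensorProduct.induction_on with
  | add u v hu hv => simp only [map_add, hu, hv]
  | smul_tprod c ξ =>
    simp only [map_smul]
    congr 1
    obtain ⟨η, rfl⟩ : ∃ η : Leaves t → H, ξ = fun i => η (σ i) := ⟨fun j => ξ (σ.symm j), by simp⟩
    choose n f hf using fun j => exists_sum_tprod (q j) (phiTree R (q j) (η j))
    rw [PiTensorProduct.reindex_tprod]
    simp only [Equiv.apply_symm_apply]
    rw [phi_graft_tprod R t q η n f hf (Classical.decEq _),
      phi_graft_tprod R s (fun i => q (σ i)) (fun i => η (σ i)) (fun i => n (σ i))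
        (fun i => f (σ i)) (fun i => hf (σ i)) (Classical.decEq _), map_sum]
    refine Fintype.sum_equiv (Equiv.piCongrLeft (fun j => Fin (n j)) σ).symm _ _ fun k => ?_
    rw [PiTensorProduct.reindex_tprod]
    congr 1
    funext a
    obtain ⟨a, rfl⟩ := (graftEquiv σ q).surjective a
    obtain ⟨⟨i, j⟩, rfl⟩ := (BTree.graftLeaves s fun i => q (σ i)).surjective a
    rw [Equiv.symm_apply_apply, graftEquiv_apply, Equiv.symm_apply_apply, Equiv.symm_apply_apply]
    rfl

theorem Represents.refine {g : Equiv.Perm UnitIco} {s t s' : BTree} {σ : Leaves s ≃ Leaves t}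
    (h : Represents g s t σ) (hs : s ≤ s') :
    ∃ (t' : BTree) (σ' : Leaves s' ≃ Leaves t'), t ≤ t' ∧ Represents g s' t' σ' := by
  obtain ⟨p, rfl⟩ := BTree.exists_graft hs
  obtain ⟨q, rfl⟩ : ∃ q : Leaves t → BTree, p = fun i => q (σ i) := ⟨fun j => p (σ.symm j), by simp⟩
  exact ⟨_, _, BTree.le_graft t q, h.graft q⟩

/-- If two pairs of trees give the same bijection and the second pair refines the first one, then
the actions on tensors are compatible. -/
theorem Represents.phi_reindex {g : Equiv.Perm UnitIco} {s t s' t' : BTree}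
    {σ : Leaves s ≃ Leaves t} {σ' : Leaves s' ≃ Leaves t'}
    (h : Represents g s t σ) (h' : Represents g s' t' σ') (hs : s ≤ s') :
    t ≤ t' ∧ ∀ x : TensorPow H s, phi R t t' (PiTensorProduct.reindex ℂ (fun _ => H) σ x) =
        PiTensorProduct.reindex ℂ (fun _ => H) σ' (phi R s s' x) := by
  obtain ⟨p, rfl⟩ := BTree.exists_graft hs
  obtain ⟨q, rfl⟩ : ∃ q : Leaves t → BTree, p = fun i => q (σ i) := ⟨fun j => p (σ.symm j), by simp⟩
  obtain ⟨e, he⟩ := (h.graft q).unique h'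
  subst e
  subst he
  exact ⟨BTree.le_graft t q, fun x => JonesThompson.phi_reindex R σ q x⟩

end

/-- Thompson's group `V`, acting on `[0, 1)`: the bijections given by two finite binary trees with
the same number of leaves and a bijection between their leaves. -/
def ThompsonV : Subgroup (Equiv.Perm UnitIco) where
  carrier := {g | ∃ s t σ, Represents g s t σ}
  one_mem' := ⟨.leaf, .leaf, _, Represents.refl _⟩
  inv_mem' := fun ⟨_, _, _, h⟩ => ⟨_, _, _, h.inv⟩
  mul_mem' := by
    rintro g h ⟨s, t, σ, hg⟩ ⟨s', t', σ', hh⟩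
    obtain ⟨u, τ, -, hu⟩ := hg.refine (BTree.le_join_left s t')
    obtain ⟨w, ρ, -, hw⟩ := hh.inv.refine (BTree.le_join_right s t')
    have := hu.mul hw.inv
    rw [inv_inv] at this
    exact ⟨_, _, _, this⟩

/-- Thompson's group `F`: the elements of `V` that are increasing on `[0, 1)`. -/
def ThompsonF : Subgroup ThompsonV where
  carrier := {g | ∀ x y : UnitIco, x < y ↔ g.1 x < g.1 y}
  one_mem' _ _ := Iff.rfl
  inv_mem' {g} hg x y := by
    have := hg (g⁻¹.1 x) (g⁻¹.1 y)
    simpa using this.symm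
  mul_mem' {g h} hg hh x y := (hh x y).trans (hg _ _)

/-- `x, y, z` are met in this order when running once around the circle `[0, 1) = ℝ / ℤ`. -/
def CyclicLt (x y z : UnitIco) : Prop := x < y ∧ y < z ∨ y < z ∧ z < x ∨ z < x ∧ x < y

/-- Thompson's group `T`: the elements of `V` that preserve the cyclic order of the circle
`[0, 1) = ℝ / ℤ`. -/
def ThompsonT : Subgroup ThompsonV where
  carrier := {g | ∀ x y z : UnitIco, CyclicLt x y z ↔ CyclicLt (g.1 x) (g.1 y) (g.1 z)}
  one_mem' _ _ _ := Iff.rfl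
  inv_mem' {g} hg x y z := by
    have := hg (g⁻¹.1 x) (g⁻¹.1 y) (g⁻¹.1 z)
    simpa using this.symm
  mul_mem' {g h} hg hh x y z := (hh x y z).trans (hg _ _ _)

/-! ### The representation of `V` -/

section Rep

variable {H : Type*} [NormedAddCommGroup H] [InnerProductSpace ℂ H] (R : H →ₗᵢ[ℂ] H ⊗[ℂ] H)

/-- The permutation of tensors `⊗ ηᵢ ↦ ⊗ η_{σ⁻¹ i}` given by a bijection between leaves. -/
def permTensor (H : Type*) [NormedAddCommGroup H] [InnerProductSpace ℂ H] {s t : BTree}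
    (σ : Leaves s ≃ Leaves t) : TensorPow H s ≃ₗ[ℂ] TensorPow H t :=
  PiTensorProduct.reindex ℂ (fun _ => H) σ

/-- Any finitely many vectors live on a tree `s` on which a given element of `V` is represented. -/
theorem exists_represents (g : ThompsonV) (x y : JonesPreSpace R) :
    ∃ (s t : BTree) (σ : Leaves s ≃ Leaves t) (ξ η : TensorPow H s), Represents g.1 s t σ ∧
      x = preClass R s ξ ∧ y = preClass R s η := by
  obtain ⟨g, s, t, σ, h⟩ := g
  obtain ⟨u, ξ, η, rfl, rfl⟩ := exists_preClass₂ R x y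
  obtain ⟨t', σ', -, h'⟩ := h.refine (BTree.le_join_left s u)
  exact ⟨_, t', σ', _, _, h', (preClass_phi R (BTree.le_join_right s u) ξ).symm,
    (preClass_phi R (BTree.le_join_right s u) η).symm⟩

theorem Represents.preClass_eq {g : Equiv.Perm UnitIco} {s t s' t' : BTree}
    {σ : Leaves s ≃ Leaves t} {σ' : Leaves s' ≃ Leaves t'}
    (h : Represents g s t σ) (h' : Represents g s' t' σ') {ξ : TensorPow H s} {η : TensorPow H s'}
    (e : preClass R s ξ = preClass R s' η) :
    preClass R t (permTensor H σ ξ) = preClass R t' (permTensor H σ' η) := by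
  obtain ⟨u, hs, hs', e⟩ := JonesThompson.preClass_eq R e
  obtain ⟨v, τ, -, hv⟩ := h.refine hs
  obtain ⟨ht, h1⟩ := h.phi_reindex R hv hs
  obtain ⟨ht', h2⟩ := h'.phi_reindex R hv hs'
  rw [← preClass_phi R ht, ← preClass_phi R ht', permTensor, permTensor, h1, h2, e]

/-- The action of `g ∈ V` on the inductive limit. -/
def preAct (g : ThompsonV) (x : JonesPreSpace R) : JonesPreSpace R :=
  let h := exists_represents R g x x
  preClass R h.choose_spec.choose
    (permTensor H h.choose_spec.choose_spec.choose h.choose_spec.choose_spec.choose_spec.choose)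

theorem preAct_preClass (g : ThompsonV) {s t : BTree} {σ : Leaves s ≃ Leaves t}
    (h : Represents g.1 s t σ) (ξ : TensorPow H s) :
    preAct R g (preClass R s ξ) = preClass R t (permTensor H σ ξ) := by
  have h' := (exists_represents R g (preClass R s ξ) (preClass R s ξ)).choose_spec.choose_spec
    |>.choose_spec.choose_spec.choose_spec
  exact h'.1.preClass_eq R h h'.2.1.symm

theorem preAct_one (x : JonesPreSpace R) : preAct R 1 x = x := by
  obtain ⟨t, ξ, rfl⟩ := exists_preClass R x
  rw [preAct_preClass R 1 (Represents.refl t)]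
  simp [permTensor]

theorem preAct_mul (g h : ThompsonV) (x : JonesPreSpace R) :
    preAct R (g * h) x = preAct R g (preAct R h x) := by
  obtain ⟨s, t, σ, ξ, -, hh, rfl, -⟩ := exists_represents R h x x
  obtain ⟨s', t', σ', hg⟩ := g.2
  obtain ⟨u, τ, -, hu⟩ := hg.refine (BTree.le_join_left s' t)
  obtain ⟨v, ρ, -, hv⟩ := hh.inv.refine (BTree.le_join_right s' t)
  have hw := hv.inv
  rw [inv_inv] at hw
  obtain ⟨hsv, -⟩ := hh.inv.phi_reindex R hv (BTree.le_join_right s' t)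
  rw [← preClass_phi R hsv, preAct_preClass R h hw, preAct_preClass R g hu,
    preAct_preClass R (g * h) (hu.mul hw)]
  simp only [permTensor]
  rw [← PiTensorProduct.reindex_trans]
  rfl

/-- The unitary action of `V` on the inductive limit. -/
def preRep : ThompsonV →* (JonesPreSpace R ≃ₗᵢ[ℂ] JonesPreSpace R) where
  toFun g :=
    { toFun := preAct R g
      invFun := preAct R g⁻¹
      left_inv := fun x => by rw [← preAct_mul, inv_mul_cancel, preAct_one]
      right_inv := fun x => by rw [← preAct_mul, mul_inv_cancel, preAct_one]
      map_add' := fun x y => by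
        obtain ⟨s, t, σ, ξ, η, h, rfl, rfl⟩ := exists_represents R g x y
        rw [← map_add, preAct_preClass R g h, preAct_preClass R g h, preAct_preClass R g h,
          map_add, map_add]
      map_smul' := fun c x => by
        obtain ⟨s, t, σ, ξ, -, h, rfl, -⟩ := exists_represents R g x x
        rw [← map_smul, preAct_preClass R g h, preAct_preClass R g h, map_smul, map_smul]
        rfl
      norm_map' := fun x => by
        obtain ⟨s, t, σ, ξ, -, h, rfl, -⟩ := exists_represents R g x x
        have key : inner ℂ (preAct R g (preClass R s ξ)) (preAct R g (preClass R s ξ)) =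
            inner ℂ (preClass R s ξ) (preClass R s ξ) := by
          rw [preAct_preClass R g h, inner_preClass, inner_preClass]
          exact tensorInner_reindex σ ξ ξ
        rw [inner_self_eq_norm_sq_to_K, inner_self_eq_norm_sq_to_K] at key
        exact (sq_eq_sq₀ (norm_nonneg _) (norm_nonneg _)).1 (by exact_mod_cast key) }
  map_one' := LinearIsometryEquiv.ext (preAct_one R)
  map_mul' g h := LinearIsometryEquiv.ext (preAct_mul R g h)

end Rep

section Completion

open UniformSpace

variable {E : Type*} [NormedAddCommGroup E] [InnerProductSpace ℂ E]

theorem completionMap_coe (e : E ≃ₗᵢ[ℂ] E) (x : E) : Completion.map e x = e x :=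
  Completion.map_coe e.isometry.uniformContinuous x

theorem completionMap_mul (e f : E ≃ₗᵢ[ℂ] E) (x : Completion E) :
    Completion.map (e * f) x = Completion.map e (Completion.map f x) := by
  rw [← Function.comp_apply (f := Completion.map e),
    Completion.map_comp e.isometry.uniformContinuous f.isometry.uniformContinuous]
  rfl

theorem completionMap_one (x : Completion E) : Completion.map (1 : E ≃ₗᵢ[ℂ] E) x = x :=
  congrFun Completion.map_id x

variable (E)

/-- Extension of unitary operators to the completion. -/
def completionHom : (E ≃ₗᵢ[ℂ] E) →* (Completion E ≃ₗᵢ[ℂ] Completion E) where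
  toFun e :=
    { toFun := Completion.map e
      invFun := Completion.map (e⁻¹ : E ≃ₗᵢ[ℂ] E)
      left_inv := fun x => by rw [← completionMap_mul, inv_mul_cancel, completionMap_one]
      right_inv := fun x => by rw [← completionMap_mul, mul_inv_cancel, completionMap_one]
      map_add' := fun x y => by
        refine Completion.induction_on₂ x y (isClosed_eq ?_ ?_) fun a b => ?_
        · exact (Completion.continuous_map (f := e)).comp continuous_add
        · exact ((Completion.continuous_map (f := e)).comp continuous_fst).add
            ((Completion.continuous_map (f := e)).comp continuous_snd)
        · rw [← Completion.coe_add, completionMap_coe, completionMap_coe, completionMap_coe,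
            map_add, Completion.coe_add]
      map_smul' := fun c x => by
        refine Completion.induction_on x (isClosed_eq ?_ ?_) fun a => ?_
        · exact Completion.continuous_map.comp (continuous_const_smul c)
        · exact (Completion.continuous_map (f := e)).const_smul c
        · rw [← Completion.coe_smul, completionMap_coe, map_smul, Completion.coe_smul]
          exact congrArg (c • ·) (completionMap_coe e a).symm
      norm_map' := fun x => by
        refine Completion.induction_on x (isClosed_eq ?_ continuous_norm) fun a => ?_
        · exact Completion.continuous_map.norm
        · refine (congrArg norm (completionMap_coe e a)).trans ?_
          rw [Completion.norm_coe, Completion.norm_coe, e.norm_map] }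
  map_one' := LinearIsometryEquiv.ext completionMap_one
  map_mul' e f := LinearIsometryEquiv.ext (completionMap_mul e f)

end Completion

section DirectSum

variable {I : Type*} {K : I → Type*} [∀ i, NormedAddCommGroup (K i)]
  [∀ i, InnerProductSpace ℂ (K i)]

theorem memℓp_map (e : ∀ i, K i ≃ₗᵢ[ℂ] K i) (f : lp K 2) : Memℓp (fun i => e i (f i)) 2 := by
  refine memℓp_gen ?_
  simp only [LinearIsometryEquiv.norm_map]
  exact (lp.memℓp f).summable (by simp)

/-- The componentwise action of unitary operators on a Hilbert direct sum. -/
def lpMap (e : ∀ i, K i ≃ₗᵢ[ℂ] K i) (f : lp K 2) : lp K 2 := ⟨fun i => e i (f i), memℓp_map e f⟩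

theorem lpMap_apply (e : ∀ i, K i ≃ₗᵢ[ℂ] K i) (f : lp K 2) (i : I) :
    lpMap e f i = e i (f i) := rfl

variable {G : Type*} [Group G]

/-- The Hilbert direct sum of a family of unitary representations. -/
def directSumRep (π : ∀ i, G →* (K i ≃ₗᵢ[ℂ] K i)) : G →* (lp K 2 ≃ₗᵢ[ℂ] lp K 2) where
  toFun g :=
    { toFun := lpMap fun i => π i g
      invFun := lpMap fun i => π i g⁻¹
      left_inv := fun f => lp.ext <| funext fun i => by
        change (π i g⁻¹ * π i g) (f i) = f i
        rw [← map_mul, inv_mul_cancel, map_one]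
        rfl
      right_inv := fun f => lp.ext <| funext fun i => by
        change (π i g * π i g⁻¹) (f i) = f i
        rw [← map_mul, mul_inv_cancel, map_one]
        rfl
      map_add' := fun f f' => lp.ext <| funext fun i => (π i g).map_add (f i) (f' i)
      map_smul' := fun c f => lp.ext <| funext fun i => (π i g).map_smul c (f i)
      norm_map' := fun f => by
        change ‖lpMap (fun i => π i g) f‖ = ‖f‖
        rw [lp.norm_eq_tsum_rpow (by simp), lp.norm_eq_tsum_rpow (by simp)]
        simp only [lpMap_apply, LinearIsometryEquiv.norm_map] }
  map_one' := LinearIsometryEquiv.ext fun f => lp.ext <| funext fun i => by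
    change π i 1 (f i) = f i
    rw [map_one]
    rfl
  map_mul' g h := LinearIsometryEquiv.ext fun f => lp.ext <| funext fun i => by
    change π i (g * h) (f i) = π i g (π i h (f i))
    rw [map_mul]
    rfl

theorem directSumRep_apply (π : ∀ i, G →* (K i ≃ₗᵢ[ℂ] K i)) (g : G) (f : lp K 2) (i : I) :
    directSumRep π g f i = π i g (f i) := rfl

end DirectSum

/-- Kazhdan's property (T) for a discrete group: every unitary representation on a Hilbert space
that has an almost invariant vector (for all finite sets `Q` and all `ε > 0` there is a unit vector
moved by less than `ε` by every element of `Q`) has a nonzero invariant vector. -/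
def HasKazhdanPropertyT.{u} (G : Type u) [Group G] : Prop :=
  ∀ (K : Type u) [NormedAddCommGroup K] [InnerProductSpace ℂ K] [CompleteSpace K]
    (π : G →* (K ≃ₗᵢ[ℂ] K)),
    (∀ (Q : Finset G) (ε : ℝ), 0 < ε → ∃ ξ : K, ‖ξ‖ = 1 ∧ ∀ g ∈ Q, ‖π g ξ - ξ‖ < ε) →
      ∃ ξ : K, ξ ≠ 0 ∧ ∀ g, π g ξ = ξ

/-- The unitary representation of `V` attached to the isometry `R`: on the vector `(s, ξ)`, an
element of `V` given by the trees `s`, `t` and the bijection `σ` between their leaves acts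
by `(s, ξ) ↦ (t, θ ξ)`, where `θ` permutes the tensor factors according to `σ`. -/
def jonesRep {H : Type*} [NormedAddCommGroup H] [InnerProductSpace ℂ H] (R : H →ₗᵢ[ℂ] H ⊗[ℂ] H) :
    ThompsonV →* (JonesSpace R ≃ₗᵢ[ℂ] JonesSpace R) :=
  (completionHom (JonesPreSpace R)).comp (preRep R)

theorem jonesRep_fraction {H : Type*} [NormedAddCommGroup H] [InnerProductSpace ℂ H]
    (R : H →ₗᵢ[ℂ] H ⊗[ℂ] H) (g : ThompsonV) {s t : BTree} {σ : Leaves s ≃ Leaves t}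
    (h : Represents g.1 s t σ) (ξ : TensorPow H s) :
    jonesRep R g (fraction R s ξ) = fraction R t (permTensor H σ ξ) := by
  refine (completionMap_coe (preRep R g) _).trans ?_
  exact congrArg _ (preAct_preClass R g h ξ)

theorem fraction_phi {H : Type*} [NormedAddCommGroup H] [InnerProductSpace ℂ H]
    (R : H →ₗᵢ[ℂ] H ⊗[ℂ] H) {s t : BTree} (h : s ≤ t) (ξ : TensorPow H s) :
    fraction R t (phi R s t ξ) = fraction R s ξ :=
  congrArg _ (preClass_phi R h ξ)

theorem inner_fraction {H : Type*} [NormedAddCommGroup H] [InnerProductSpace ℂ H]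
    (R : H →ₗᵢ[ℂ] H ⊗[ℂ] H) (t : BTree) (ξ η : TensorPow H t) :
    inner ℂ (fraction R t ξ) (fraction R t η) = tensorInner ξ η :=
  (UniformSpace.Completion.inner_coe _ _).trans (inner_preClass R t ξ η)

/-! ### The representation without invariant vectors -/

/-- The isometry `ξ ↦ u ξ ⊗ ζ`, for a unitary `u` and a unit vector `ζ`. -/
def tensorIsometry {H : Type*} [NormedAddCommGroup H] [InnerProductSpace ℂ H] (u : H ≃ₗᵢ[ℂ] H)
    (ζ : H) (hζ : ‖ζ‖ = 1) : H →ₗᵢ[ℂ] H ⊗[ℂ] H where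
  toFun ξ := u ξ ⊗ₜ ζ
  map_add' ξ η := by rw [map_add, TensorProduct.add_tmul]
  map_smul' c ξ := by rw [map_smul, TensorProduct.smul_tmul']; rfl
  norm_map' ξ := by
    change ‖u ξ ⊗ₜ[ℂ] ζ‖ = ‖ξ‖
    rw [TensorProduct.norm_tmul, hζ, mul_one, u.norm_map]

/-- The Hilbert space `ℓ²(ℤ)`. -/
abbrev EllTwoZ := lp (fun _ : ℤ => ℂ) 2

theorem memℓp_comp (e : ℤ ≃ ℤ) (f : EllTwoZ) : Memℓp (fun n => f (e n)) 2 :=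
  memℓp_gen (((lp.memℓp f).summable (by simp)).comp_injective e.injective)

/-- The shift operator on `ℓ²(ℤ)`, `(u ξ)(n) = ξ(n - 1)`. -/
def shift : EllTwoZ ≃ₗᵢ[ℂ] EllTwoZ where
  toFun f := ⟨fun n => f (n - 1), memℓp_comp (Equiv.subRight 1) f⟩
  invFun f := ⟨fun n => f (n + 1), memℓp_comp (Equiv.addRight 1) f⟩
  left_inv f := lp.ext <| funext fun n => congrArg f (add_sub_cancel_right n 1)
  right_inv f := lp.ext <| funext fun n => congrArg f (sub_add_cancel n 1)
  map_add' _ _ := rfl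
  map_smul' _ _ := rfl
  norm_map' f := by
    rw [lp.norm_eq_tsum_rpow (by simp), lp.norm_eq_tsum_rpow (by simp)]
    congr 1
    exact (Equiv.subRight (1 : ℤ)).tsum_eq fun n => ‖f n‖ ^ (2 : ENNReal).toReal

/-- `h(m) = 2 m 8 ^ m`. -/
def hSeq (m : ℕ+) : ℕ := 2 * m * 8 ^ (m : ℕ)

/-- The vector `ζ_m ∈ ℓ²(ℤ)`: the characteristic function of `{1, 2, …, h(m)}` divided
by `√h(m)`. -/
def zeta (m : ℕ+) : EllTwoZ :=
  ∑ k ∈ Finset.Icc (1 : ℤ) (hSeq m), lp.single 2 k ((1 / Real.sqrt (hSeq m) : ℝ) : ℂ)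

theorem norm_zeta (m : ℕ+) : ‖zeta m‖ = 1 := by
  have hpos : (0 : ℝ) < hSeq m := by
    have := m.pos
    simp only [hSeq]
    positivity
  have h := lp.norm_sum_single (E := fun _ : ℤ => ℂ) (p := 2) (by simp)
    (fun _ => ((1 / Real.sqrt (hSeq m) : ℝ) : ℂ)) (Finset.Icc (1 : ℤ) (hSeq m))
  change ‖zeta m‖ ^ _ = _ at h
  simp [abs_of_nonneg (Real.sqrt_nonneg _), hpos.ne'] at h
  exact h.resolve_right (by linarith [norm_nonneg (zeta m)])

/-- The isometry `R(ξ) = u ξ ⊗ ζ_m` on `ℓ²(ℤ)`. -/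
def kazhdanIsometry (m : ℕ+) : EllTwoZ →ₗᵢ[ℂ] EllTwoZ ⊗[ℂ] EllTwoZ :=
  tensorIsometry shift (zeta m) (norm_zeta m)

/-- The Hilbert space of the direct sum over `m ≥ 1` of the Jones representations. -/
abbrev KazhdanSpace : Type := lp (fun m : ℕ+ => JonesSpace (kazhdanIsometry m)) 2

/-- The direct sum over `m ≥ 1` of the Jones representations of `V` attached to
`R(ξ) = u ξ ⊗ ζ_m`. -/
def kazhdanRep : ThompsonV →* (KazhdanSpace ≃ₗᵢ[ℂ] KazhdanSpace) :=
  directSumRep fun m => jonesRep (kazhdanIsometry m)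

/-- The vector with `m`-th component `(t_m, ζ_m ⊗ ⋯ ⊗ ζ_m)` and all other components zero, with
`t_m` the complete binary tree with `2 ^ m` leaves. -/
def kazhdanVector (m : ℕ+) : KazhdanSpace :=
  lp.single 2 m
    (fraction (kazhdanIsometry m) (BTree.complete m) (PiTensorProduct.tprod ℂ fun _ => zeta m))

end JonesThompson

end

open JonesThompson

/-! The inductive limit carries a join (a, b) ↦ a * b, obtained by hanging two trees below a new
root. Three facts make it useful. Inner products of joins multiply (`inner_preJoin`). An element of
V × V acting on the two halves of [0, 1) acts factorwise (`preRep_pairV`), while the generator x₀ of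
F re-brackets, (a * b) * c ↦ a * (b * c) (`preRep_xZero`). For R(ξ) = uξ ⊗ ζ, a one-leaf vector
satisfies ξ = uξ * ζ.

No invariant vectors. Iterating the last two rules, x₀ⁿ sends ξ to the join of uⁿ⁺¹ξ with a right
comb of n + 1 copies of ζ. Comparing that comb with the repeated expansion of ζ produces one factor
⟨ζ, uζ⟩ per level, so matrix coefficients of x₀ⁿ on one-leaf vectors are O(|⟨ζ, uζ⟩|ⁿ), and they
tend to 0 because |⟨ζ_m, uζ_m⟩| < 1. Since x₀ is not in [F, F], it is replaced by a commutator that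
acts as x₀ⁿ on one quarter of [0, 1) and as x₀⁻ⁿ on another; the second factor is merely bounded.
Squeezing this commutator into the first dyadic interval of depth k gives decay on all vectors
living on the complete tree of depth k, hence along a sequence in [F, F] for every vector of the
inductive limit. A density argument then excludes invariant vectors in the completion
(`eq_zero_of_jonesRep_invariant`).

Almost invariance. A permutation of the leaves fixes ζ_m ⊗ ⋯ ⊗ ζ_m, so a given g sends (t_m, ζ_m ⊗
⋯) to (t', ζ_m ⊗ ⋯) with t' of height at most 2m once m is large. On the common refinement of t_m
and t', the complete tree with 4ᵐ leaves, both vectors become elementary tensors of shifts uᵏζ_m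
with 0 ≤ k ≤ 2m. Two such shifts have inner product at least 1 - 2m/h(m) = 1 - 8⁻ᵐ, so the two unit
vectors have inner product at least (1 - 8⁻ᵐ)^(4ᵐ) ≥ 1 - 2⁻ᵐ by Bernoulli's inequality. -/

noncomputable section

namespace JonesThompson

open scoped TensorProduct

/-! ### Joining two vectors of the inductive limit at a new root -/

section Join

variable {H : Type*} [NormedAddCommGroup H] [InnerProductSpace ℂ H]

/-- The function on the leaves of `node l r` given by functions on those of `l` and of `r`. -/
def leavesElim {α : Type*} {l r : BTree} (x : Leaves l → α) (y : Leaves r → α) :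
    Leaves (.node l r) → α :=
  Sum.elim x y

/-- The bijection between leaves given by bijections on both sides of the root. -/
def leavesCongr {s t s' t' : BTree} (σ : Leaves s ≃ Leaves t) (τ : Leaves s' ≃ Leaves t') :
    Leaves (.node s s') ≃ Leaves (.node t t') :=
  σ.sumCongr τ

/-- The bijection between the leaves of two trees that differ by an associativity move. -/
def leavesAssoc (p q r : BTree) : Leaves (.node (.node p q) r) ≃ Leaves (.node p (.node q r)) :=
  Equiv.sumAssoc (Leaves p) (Leaves q) (Leaves r)

theorem joinTensor_tprod (l r : BTree) (x : Leaves l → H) (y : Leaves r → H) :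
    joinTensor l r (PiTensorProduct.tprod ℂ x ⊗ₜ PiTensorProduct.tprod ℂ y) =
      PiTensorProduct.tprod ℂ (leavesElim x y) :=
  PiTensorProduct.tmulEquiv_apply ℂ H x y

theorem permTensor_tprod {s t : BTree} (σ : Leaves s ≃ Leaves t) (x : Leaves s → H) :
    permTensor H σ (PiTensorProduct.tprod ℂ x) =
      PiTensorProduct.tprod ℂ fun i => x (σ.symm i) :=
  PiTensorProduct.reindex_tprod σ x

theorem leafTensor_symm_apply (x : H) :
    leafTensor.symm x = PiTensorProduct.tprod ℂ fun _ : Leaves .leaf => x :=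
  PiTensorProduct.subsingletonEquiv_symm_apply' (ι := Unit) () x

variable (R : H →ₗᵢ[ℂ] H ⊗[ℂ] H)

theorem phi_joinTensor {l r l' r' : BTree} (x : TensorPow H l) (y : TensorPow H r) :
    phi R (.node l r) (.node l' r') (joinTensor l r (x ⊗ₜ y)) =
      joinTensor l' r' (phi R l l' x ⊗ₜ phi R r r' y) := by
  simp [phi]

/-- The map `((l, ξ), (r, η)) ↦ (node l r, ξ ⊗ η)` on the inductive limit. -/
def preJoin : JonesPreSpace R → JonesPreSpace R → JonesPreSpace R :=
  DirectLimit.lift₂ (fun s t (_ : s ≤ t) => phi R s t) (fun s t (_ : s ≤ t) => phi R s t)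
    -- The lift only sees pairs of vectors on one common tree; `preJoin_preClass` recovers the case
    -- of two different trees by refining both to their `BTree.join`.
    (fun t x y => preClass R (.node t t) (joinTensor t t (x ⊗ₜ y))) fun s t h x y => by
      have h' : BTree.node s s ≤ .node t t := ⟨h, h⟩
      rw [← phi_joinTensor, preClass_phi R h']

theorem preJoin_preClass (l r : BTree) (x : TensorPow H l) (y : TensorPow H r) :
    preJoin R (preClass R l x) (preClass R r y) =
      preClass R (.node l r) (joinTensor l r (x ⊗ₜ y)) := by
  have hl := BTree.le_join_left l r
  have hr := BTree.le_join_right l r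
  have h' : BTree.node l r ≤ .node (BTree.join l r) (BTree.join l r) := ⟨hl, hr⟩
  rw [← preClass_phi R hl, ← preClass_phi R hr, ← preClass_phi R h', phi_joinTensor]
  exact DirectLimit.lift₂_def ..

theorem inner_preJoin (a b c d : JonesPreSpace R) :
    inner ℂ (preJoin R a b) (preJoin R c d) = inner ℂ a c * inner ℂ b d := by
  obtain ⟨s, x, z, rfl, rfl⟩ := exists_preClass₂ R a c
  obtain ⟨t, y, w, rfl, rfl⟩ := exists_preClass₂ R b d
  simp only [preJoin_preClass, inner_preClass, tensorInner_joinTensor]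

/-- The vector `(leaf, ξ)` of the inductive limit. -/
def preLeaf (ξ : H) : JonesPreSpace R := preClass R .leaf (leafTensor.symm ξ)

theorem inner_preLeaf (ξ η : H) : inner ℂ (preLeaf R ξ) (preLeaf R η) = inner ℂ ξ η := by
  rw [preLeaf, preLeaf, inner_preClass, tensorInner_leafTensor_symm]

/-- This is the defining identification (t, ξ) ∼ (p ∘ t, Φ(p)ξ) for the forest p with a single
vertex. It is the only place where R enters the computations with joins. -/
theorem preLeaf_eq_preJoin {ξ η ζ : H} (h : R ξ = η ⊗ₜ ζ) :
    preLeaf R ξ = preJoin R (preLeaf R η) (preLeaf R ζ) := by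
  have h' : BTree.leaf ≤ .node .leaf .leaf := trivial
  rw [preLeaf, preLeaf, preLeaf, preJoin_preClass, ← preClass_phi R h']
  simp [phi, phiTree, h]

end Join

/-! ### Some elements of Thompson's groups -/

theorem lowerHalf_lt_lowerHalf {x y : UnitIco} : lowerHalf x < lowerHalf y ↔ x < y := by
  rw [← Subtype.coe_lt_coe, ← Subtype.coe_lt_coe]
  simp only [lowerHalf]
  constructor <;> intro h <;> linarith

theorem upperHalf_lt_upperHalf {x y : UnitIco} : upperHalf x < upperHalf y ↔ x < y := by
  rw [← Subtype.coe_lt_coe, ← Subtype.coe_lt_coe]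
  simp only [upperHalf]
  constructor <;> intro h <;> linarith

theorem lowerHalf_lt_upperHalf (x y : UnitIco) : lowerHalf x < upperHalf y := by
  rw [← Subtype.coe_lt_coe]
  have := x.2.2
  have := y.2.1
  simp only [lowerHalf, upperHalf]
  linarith

theorem not_upperHalf_lt_lowerHalf (x y : UnitIco) : ¬ upperHalf x < lowerHalf y :=
  (lowerHalf_lt_upperHalf y x).not_gt

theorem bijective_elim_halves : Function.Bijective (Sum.elim lowerHalf upperHalf) := by
  refine ⟨?_, fun x => ?_⟩
  · rintro (x | x) (y | y) h
    · exact congrArg _ (lowerHalf_injective h)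
    · exact (lowerHalf_ne_upperHalf _ _ h).elim
    · exact (lowerHalf_ne_upperHalf _ _ h.symm).elim
    · exact congrArg _ (upperHalf_injective h)
  · obtain ⟨i | i, y, h⟩ := chart_surjective (.node .leaf .leaf) x
    · exact ⟨.inl y, h⟩
    · exact ⟨.inr y, h⟩

/-- The decomposition of `[0, 1)` into its two halves. -/
def halvesEquiv : UnitIco ⊕ UnitIco ≃ UnitIco := .ofBijective _ bijective_elim_halves

theorem halvesEquiv_symm_lowerHalf (x : UnitIco) : halvesEquiv.symm (lowerHalf x) = .inl x :=
  halvesEquiv.symm_apply_apply (.inl x)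

theorem halvesEquiv_symm_upperHalf (x : UnitIco) : halvesEquiv.symm (upperHalf x) = .inr x :=
  halvesEquiv.symm_apply_apply (.inr x)

theorem halves_cases {p : UnitIco → Prop} (hl : ∀ x, p (lowerHalf x)) (hr : ∀ x, p (upperHalf x))
    (x : UnitIco) : p x := by
  obtain ⟨x | x, rfl⟩ := halvesEquiv.surjective x
  exacts [hl x, hr x]

/-- The bijection acting as `g` on the lower half and as `h` on the upper half of `[0, 1)`. -/
def pairPerm (g h : Equiv.Perm UnitIco) : Equiv.Perm UnitIco :=
  (halvesEquiv.symm.trans (g.sumCongr h)).trans halvesEquiv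

theorem pairPerm_lowerHalf (g h : Equiv.Perm UnitIco) (x : UnitIco) :
    pairPerm g h (lowerHalf x) = lowerHalf (g x) := by
  simp only [pairPerm, Equiv.trans_apply, halvesEquiv_symm_lowerHalf]
  rfl

theorem pairPerm_upperHalf (g h : Equiv.Perm UnitIco) (x : UnitIco) :
    pairPerm g h (upperHalf x) = upperHalf (h x) := by
  simp only [pairPerm, Equiv.trans_apply, halvesEquiv_symm_upperHalf]
  rfl

theorem represents_pairPerm {g h : Equiv.Perm UnitIco} {s t s' t' : BTree}
    {σ : Leaves s ≃ Leaves t} {τ : Leaves s' ≃ Leaves t'} (hg : Represents g s t σ)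
    (hh : Represents h s' t' τ) :
    Represents (pairPerm g h) (.node s s') (.node t t') (leavesCongr σ τ) := by
  rintro (i | i) x
  · exact (pairPerm_lowerHalf _ _ _).trans (congrArg lowerHalf (hg i x))
  · exact (pairPerm_upperHalf _ _ _).trans (congrArg upperHalf (hh i x))

/-- The homomorphism `V × V → V` given by the actions on the two halves of `[0, 1)`. -/
def pairV : ThompsonV × ThompsonV →* ThompsonV where
  toFun g := ⟨pairPerm g.1 g.2, by
    obtain ⟨⟨g, s, t, σ, hg⟩, ⟨h, s', t', τ, hh⟩⟩ := g
    exact ⟨_, _, _, represents_pairPerm hg hh⟩⟩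
  map_one' := Subtype.ext <| Equiv.ext <| halves_cases
    (fun _ => pairPerm_lowerHalf _ _ _) (fun _ => pairPerm_upperHalf _ _ _)
  map_mul' g h := Subtype.ext <| Equiv.ext <| halves_cases
    (fun x => by simp [pairPerm_lowerHalf]) (fun x => by simp [pairPerm_upperHalf])

theorem pairV_mem_thompsonF {g h : ThompsonV} (hg : g ∈ ThompsonF) (hh : h ∈ ThompsonF) :
    pairV (g, h) ∈ ThompsonF := by
  refine halves_cases (fun x => halves_cases (fun y => ?_) fun y => ?_)
    (fun x => halves_cases (fun y => ?_) fun y => ?_)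
  · simpa [pairV, pairPerm_lowerHalf, lowerHalf_lt_lowerHalf] using hg x y
  · simp [pairV, pairPerm_lowerHalf, pairPerm_upperHalf, lowerHalf_lt_upperHalf]
  · simp only [pairV, MonoidHom.coe_mk, OneHom.coe_mk, pairPerm_lowerHalf, pairPerm_upperHalf,
      not_upperHalf_lt_lowerHalf]
  · simpa [pairV, pairPerm_upperHalf, upperHalf_lt_upperHalf] using hh x y

/-- The bijection of `[0, 1)` mapping the intervals `00`, `01`, `1` onto `0`, `10`, `11`. -/
def assocPerm : Equiv.Perm UnitIco :=
  ((((halvesEquiv.sumCongr (.refl _)).trans halvesEquiv).symm.trans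
    (Equiv.sumAssoc _ _ _)).trans ((Equiv.refl _).sumCongr halvesEquiv)).trans halvesEquiv

theorem assocPerm_lowerHalf_lowerHalf (x : UnitIco) :
    assocPerm (lowerHalf (lowerHalf x)) = lowerHalf x := by
  simp [assocPerm, halvesEquiv_symm_lowerHalf]
  rfl

theorem assocPerm_lowerHalf_upperHalf (x : UnitIco) :
    assocPerm (lowerHalf (upperHalf x)) = upperHalf (lowerHalf x) := by
  simp [assocPerm, halvesEquiv_symm_lowerHalf, halvesEquiv_symm_upperHalf]
  rfl

theorem assocPerm_upperHalf (x : UnitIco) :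
    assocPerm (upperHalf x) = upperHalf (upperHalf x) := by
  simp [assocPerm, halvesEquiv_symm_upperHalf]
  rfl

/-- Arbitrary trees hang below the three leaves, so that x₀ can be evaluated on a join of three
vectors without refining its pair of trees. -/
theorem represents_assocPerm (p q r : BTree) :
    Represents assocPerm (.node (.node p q) r) (.node p (.node q r))
      (leavesAssoc p q r) := by
  rintro ((i | i) | i) x
  · exact assocPerm_lowerHalf_lowerHalf _
  · exact assocPerm_lowerHalf_upperHalf _
  · exact assocPerm_upperHalf _

/-- The standard generator `x₀` of `F`. -/
def xZero : ThompsonV := ⟨assocPerm, _, _, _, represents_assocPerm .leaf .leaf .leaf⟩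

theorem xZero_mem_thompsonF : xZero ∈ ThompsonF := by
  -- Each of the two points lies in 00, 01 or 1; in all nine cases both sides of the equivalence
  -- reduce to the same statement.
  refine halves_cases (halves_cases (fun x => ?_) fun x => ?_) fun x => ?_ <;>
  refine halves_cases (halves_cases (fun y => ?_) fun y => ?_) fun y => ?_ <;>
  simp only [xZero, assocPerm_lowerHalf_lowerHalf, assocPerm_lowerHalf_upperHalf,
    assocPerm_upperHalf, lowerHalf_lt_lowerHalf, upperHalf_lt_upperHalf, lowerHalf_lt_upperHalf,
    not_upperHalf_lt_lowerHalf]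

theorem thompsonF_le_thompsonT : ThompsonF ≤ ThompsonT := fun g hg x y z => by
  simp only [CyclicLt]
  rw [hg x y, hg y z, hg z x]

theorem commutator_thompsonF_le_thompsonF : ⁅ThompsonF, ThompsonF⁆ ≤ ThompsonF :=
  Subgroup.commutator_le.2 fun _ hg _ hh =>
    mul_mem (mul_mem (mul_mem hg hh) (inv_mem hg)) (inv_mem hh)

/-- The map g ↦ `pairV (g, 1)` is a homomorphism carrying F into F, so it carries commutators of F
to commutators of F. -/
theorem pairV_one_mem_commutator {g : ThompsonV} (hg : g ∈ ⁅ThompsonF, ThompsonF⁆) :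
    pairV (g, 1) ∈ ⁅ThompsonF, ThompsonF⁆ := by
  let f : ThompsonV →* ThompsonV := pairV.comp (MonoidHom.inl _ _)
  have hf : ThompsonF.map f ≤ ThompsonF := by
    rintro _ ⟨h, hh, rfl⟩
    exact pairV_mem_thompsonF hh (one_mem _)
  have h1 : f g ∈ ⁅ThompsonF, ThompsonF⁆.map f := ⟨g, hg, rfl⟩
  rw [Subgroup.map_commutator] at h1
  exact Subgroup.commutator_mono hf hf h1

/-! ### The action of V on joins -/

section Action

variable {H : Type*} [NormedAddCommGroup H] [InnerProductSpace ℂ H] (R : H →ₗᵢ[ℂ] H ⊗[ℂ] H)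

theorem permTensor_leavesCongr {s t s' t' : BTree} (σ : Leaves s ≃ Leaves t)
    (τ : Leaves s' ≃ Leaves t') (x : TensorPow H s) (y : TensorPow H s') :
    permTensor H (leavesCongr σ τ) (joinTensor s s' (x ⊗ₜ y)) =
      joinTensor t t' (permTensor H σ x ⊗ₜ permTensor H τ y) := by
  obtain ⟨n, f, rfl⟩ := exists_sum_tprod s x
  obtain ⟨m, g, rfl⟩ := exists_sum_tprod s' y
  simp only [TensorProduct.sum_tmul, TensorProduct.tmul_sum, map_sum, joinTensor_tprod,
    permTensor_tprod]
  refine Finset.sum_congr rfl fun i _ => Finset.sum_congr rfl fun j _ => ?_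
  refine congrArg (PiTensorProduct.tprod ℂ) (funext fun a => ?_)
  obtain a | a := a <;> rfl

theorem permTensor_leavesAssoc_tprod {p q r : BTree} (x : Leaves p → H) (y : Leaves q → H)
    (z : Leaves r → H) :
    permTensor H (leavesAssoc p q r) (joinTensor (.node p q) r
        (joinTensor p q (PiTensorProduct.tprod ℂ x ⊗ₜ PiTensorProduct.tprod ℂ y) ⊗ₜ
          PiTensorProduct.tprod ℂ z)) =
      joinTensor p (.node q r) (PiTensorProduct.tprod ℂ x ⊗ₜ
        joinTensor q r (PiTensorProduct.tprod ℂ y ⊗ₜ PiTensorProduct.tprod ℂ z)) := by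
  rw [joinTensor_tprod, joinTensor_tprod, joinTensor_tprod, joinTensor_tprod, permTensor_tprod]
  refine congrArg (PiTensorProduct.tprod ℂ) (funext fun a => ?_)
  obtain a | a | a := a <;> rfl

theorem permTensor_leavesAssoc {p q r : BTree} (x : TensorPow H p) (y : TensorPow H q)
    (z : TensorPow H r) :
    permTensor H (leavesAssoc p q r)
        (joinTensor (.node p q) r (joinTensor p q (x ⊗ₜ y) ⊗ₜ z)) =
      joinTensor p (.node q r) (x ⊗ₜ joinTensor q r (y ⊗ₜ z)) := by
  obtain ⟨n, f, rfl⟩ := exists_sum_tprod p x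
  obtain ⟨m, g, rfl⟩ := exists_sum_tprod q y
  obtain ⟨k, h, rfl⟩ := exists_sum_tprod r z
  simp only [TensorProduct.sum_tmul, TensorProduct.tmul_sum, map_sum,
    permTensor_leavesAssoc_tprod]

theorem preRep_preClass (g : ThompsonV) {s t : BTree} {σ : Leaves s ≃ Leaves t}
    (h : Represents g.1 s t σ) (ξ : TensorPow H s) :
    preRep R g (preClass R s ξ) = preClass R t (permTensor H σ ξ) :=
  preAct_preClass R g h ξ

theorem preRep_pairV (g h : ThompsonV) (a b : JonesPreSpace R) :
    preRep R (pairV (g, h)) (preJoin R a b) = preJoin R (preRep R g a) (preRep R h b) := by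
  obtain ⟨s, t, σ, x, -, hg, rfl, -⟩ := exists_represents R g a a
  obtain ⟨s', t', τ, y, -, hh, rfl, -⟩ := exists_represents R h b b
  rw [preJoin_preClass, preRep_preClass R g hg, preRep_preClass R h hh, preJoin_preClass,
    preRep_preClass R _ (represents_pairPerm hg hh), permTensor_leavesCongr]

/-- x₀ sends the intervals 00, 01, 1 to 0, 10, 11 in this order, so it moves no tensor factor past
another and only changes the bracketing. -/
theorem preRep_xZero (a b c : JonesPreSpace R) :
    preRep R xZero (preJoin R (preJoin R a b) c) = preJoin R a (preJoin R b c) := by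
  obtain ⟨p, x, rfl⟩ := exists_preClass R a
  obtain ⟨q, y, rfl⟩ := exists_preClass R b
  obtain ⟨r, z, rfl⟩ := exists_preClass R c
  simp only [preJoin_preClass]
  rw [preRep_preClass R xZero (represents_assocPerm p q r), permTensor_leavesAssoc]

theorem preRep_mul_apply (g h : ThompsonV) (a : JonesPreSpace R) :
    preRep R (g * h) a = preRep R g (preRep R h a) := by
  rw [map_mul]; rfl

theorem preRep_one_apply (a : JonesPreSpace R) : preRep R 1 a = a := by
  rw [map_one]; rfl

theorem preRep_xZero_inv (a b c : JonesPreSpace R) :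
    preRep R xZero⁻¹ (preJoin R a (preJoin R b c)) = preJoin R (preJoin R a b) c := by
  rw [← preRep_xZero, ← preRep_mul_apply, inv_mul_cancel, preRep_one_apply]

/-- The commutator of an element acting as `g` on the interval `01` with `x₀`. It acts as `g` on
the interval `01` and as `g⁻¹` on the interval `10`. -/
def innerCommutator (g : ThompsonV) : ThompsonV :=
  pairV (pairV (1, g), 1) * xZero * (pairV (pairV (1, g), 1))⁻¹ * xZero⁻¹

theorem innerCommutator_mem {g : ThompsonV} (hg : g ∈ ThompsonF) :
    innerCommutator g ∈ ⁅ThompsonF, ThompsonF⁆ :=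
  Subgroup.commutator_mem_commutator
    (pairV_mem_thompsonF (pairV_mem_thompsonF (one_mem _) hg) (one_mem _)) xZero_mem_thompsonF

/-- Since x₀ carries the interval 01 onto 10, conjugating by x₀ the copy of g⁻¹ on 01 yields a copy
of g⁻¹ on 10. The action is thus diagonal on fourfold joins, although g itself need not lie in [F,
F]. -/
theorem preRep_innerCommutator (g : ThompsonV) (a b c d : JonesPreSpace R) :
    preRep R (innerCommutator g) (preJoin R (preJoin R a b) (preJoin R c d)) =
      preJoin R (preJoin R a (preRep R g b)) (preJoin R (preRep R g⁻¹ c) d) := by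
  simp only [innerCommutator, preRep_mul_apply, preRep_xZero_inv,
    ← map_inv, Prod.inv_mk, inv_one, preRep_pairV, preRep_one_apply, preRep_xZero]

end Action

/-! ### Heights of trees -/

namespace BTree

/-- The largest distance from the root to a leaf. -/
def height : BTree → ℕ
  | .leaf => 0
  | .node l r => max (height l) (height r) + 1

theorem height_complete : ∀ n, height (complete n) = n
  | 0 => rfl
  | n + 1 => by rw [complete, height, height_complete n, max_self]

theorem card_leaves_complete : ∀ n, Fintype.card (Leaves (complete n)) = 2 ^ n
  | 0 => rfl
  | n + 1 => by
    refine (Fintype.card_sum (α := Leaves (complete n)) (β := Leaves (complete n))).trans ?_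
    rw [card_leaves_complete n, pow_succ, mul_two]

theorem le_complete : ∀ (t : BTree) {n : ℕ}, height t ≤ n → t ≤ complete n
  | .leaf, _, _ => trivial
  | .node _ _, 0, h => absurd h (Nat.not_succ_le_zero _)
  | .node l r, _ + 1, h =>
    have h' := max_le_iff.1 (Nat.le_of_succ_le_succ h)
    ⟨le_complete l h'.1, le_complete r h'.2⟩

theorem height_graft_le : ∀ (t : BTree) (p : Leaves t → BTree) (n : ℕ),
    (∀ i, height (p i) ≤ n) → height (graft t p) ≤ height t + n
  | .leaf, _, _, h => (h ()).trans (Nat.le_add_left _ _)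
  | .node l r, p, n, h => by
    have h1 := height_graft_le l (fun i => p (.inl i)) n fun i => h (.inl i)
    have h2 := height_graft_le r (fun i => p (.inr i)) n fun i => h (.inr i)
    simp only [graft, height]
    omega

theorem height_le_height_graft : ∀ (t : BTree) (p : Leaves t → BTree) (i : Leaves t),
    height (p i) ≤ height (graft t p)
  | .leaf, _, _ => le_rfl
  | .node l r, p, .inl i => by
    have := height_le_height_graft l (fun i => p (.inl i)) i
    simp only [graft, height]
    omega
  | .node l r, p, .inr i => by
    have := height_le_height_graft r (fun i => p (.inr i)) i
    simp only [graft, height]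
    omega

end BTree

/-- The trees attached to t are those attached to s, moved by σ; each of them is a subtree of s', so
its height is at most that of s'. -/
theorem Represents.refine_height_le {g : Equiv.Perm UnitIco} {s t s' : BTree}
    {σ : Leaves s ≃ Leaves t} (h : Represents g s t σ) (hs : s ≤ s') :
    ∃ (t' : BTree) (σ' : Leaves s' ≃ Leaves t'), Represents g s' t' σ' ∧
      t'.height ≤ t.height + s'.height := by
  obtain ⟨p, rfl⟩ := BTree.exists_graft hs
  obtain ⟨q, rfl⟩ : ∃ q : Leaves t → BTree, p = fun i => q (σ i) := ⟨fun j => p (σ.symm j), by simp⟩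
  refine ⟨_, _, h.graft q, BTree.height_graft_le t q _ fun j => ?_⟩
  simpa using BTree.height_le_height_graft s (fun i => q (σ i)) (σ.symm j)

/-! ### Decay of matrix coefficients and absence of [F, F]-invariant vectors -/

section NoInvariantVectors

open Filter Topology

variable {H : Type*} [NormedAddCommGroup H] [InnerProductSpace ℂ H] (u : H ≃ₗᵢ[ℂ] H) (ζ : H)
  (hζ : ‖ζ‖ = 1)

local notation "RR" => tensorIsometry u ζ hζ

theorem preLeaf_tensorIsometry (ξ : H) :
    preLeaf RR ξ = preJoin RR (preLeaf RR (u ξ)) (preLeaf RR ζ) :=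
  preLeaf_eq_preJoin RR rfl

/-- The vector `ζ ⊗ ⋯ ⊗ ζ` on the right comb with `n + 1` leaves. -/
def rightComb : ℕ → JonesPreSpace RR
  | 0 => preLeaf RR ζ
  | n + 1 => preJoin RR (preLeaf RR ζ) (rightComb n)

/-- At each step the leftmost one-leaf vector η splits as uη * ζ, and x₀ moves the new ζ over to the
comb on the right. -/
theorem preRep_xZero_pow (ξ : H) (n : ℕ) :
    preRep RR (xZero ^ n) (preLeaf RR ξ) =
      preJoin RR (preLeaf RR ((u ^ (n + 1)) ξ)) (rightComb u ζ hζ n) := by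
  induction n with
  | zero => rw [pow_zero, preRep_one_apply, preLeaf_tensorIsometry, zero_add, pow_one, rightComb]
  | succ n ih =>
    rw [pow_succ', preRep_mul_apply, ih, preLeaf_tensorIsometry, preRep_xZero, pow_succ' u (n + 1)]
    rfl

/-- Writing ζ = uζ * ζ, the first teeth pair to ⟨ζ, uζ⟩, and what remains is the comb with one tooth
less paired again with ζ. -/
theorem inner_rightComb (n : ℕ) :
    inner ℂ (rightComb u ζ hζ n) (preLeaf RR ζ) = inner ℂ ζ (u ζ) ^ n := by
  induction n with
  | zero =>
    rw [rightComb, inner_preLeaf, inner_self_eq_norm_sq_to_K, hζ]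
    simp
  | succ n ih =>
    rw [rightComb, preLeaf_tensorIsometry u ζ hζ ζ, inner_preJoin, ← preLeaf_tensorIsometry, ih,
      inner_preLeaf, pow_succ']

theorem norm_inner_xZero_pow_le (ξ η : H) (n : ℕ) :
    ‖inner ℂ (preRep RR (xZero ^ n) (preLeaf RR ξ)) (preLeaf RR η)‖ ≤
      ‖ξ‖ * ‖η‖ * ‖inner ℂ ζ (u ζ)‖ ^ n := by
  rw [preRep_xZero_pow, preLeaf_tensorIsometry u ζ hζ η, inner_preJoin, inner_rightComb, norm_mul,
    norm_pow, inner_preLeaf]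
  refine mul_le_mul_of_nonneg_right ?_ (by positivity)
  exact (norm_inner_le_norm _ _).trans_eq (by simp only [LinearIsometryEquiv.norm_map])

theorem norm_preLeaf (ξ : H) : ‖preLeaf RR ξ‖ = ‖ξ‖ := by
  have h := inner_preLeaf RR ξ ξ
  rw [inner_self_eq_norm_sq_to_K, inner_self_eq_norm_sq_to_K] at h
  exact (sq_eq_sq₀ (norm_nonneg _) (norm_nonneg _)).1 (by exact_mod_cast h)

variable {u ζ}

/-- The matrix coefficient factors over the four quarters of [0, 1): the quarter 01 contributes the
decay of x₀ⁿ, and the other three stay bounded. -/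
theorem tendsto_inner_innerCommutator_preLeaf (hu : ‖inner ℂ ζ (u ζ)‖ < 1) (ξ η : H) :
    Tendsto (fun n : ℕ => inner ℂ (preRep RR (innerCommutator (xZero ^ n)) (preLeaf RR ξ))
      (preLeaf RR η)) atTop (𝓝 0) := by
  -- A one-leaf vector must be expanded to depth two before the quarters 01 and 10 become visible.
  have hξ : ∀ ξ : H, preLeaf RR ξ = preJoin RR
      (preJoin RR (preLeaf RR (u (u ξ))) (preLeaf RR ζ))
      (preJoin RR (preLeaf RR (u ζ)) (preLeaf RR ζ)) := fun ξ => by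
    rw [← preLeaf_tensorIsometry, ← preLeaf_tensorIsometry, ← preLeaf_tensorIsometry]
  refine squeeze_zero_norm (a := fun n => ‖ξ‖ * ‖η‖ * ‖inner ℂ ζ (u ζ)‖ ^ n) (fun n => ?_) ?_
  · rw [hξ ξ, hξ η, preRep_innerCommutator]
    simp only [inner_preJoin, norm_mul]
    have h1 := norm_inner_xZero_pow_le u ζ hζ ζ ζ n
    have h2 : ‖inner ℂ (preLeaf RR (u (u ξ))) (preLeaf RR (u (u η)))‖ ≤ ‖ξ‖ * ‖η‖ :=
      (norm_inner_le_norm _ _).trans_eq (by simp [norm_preLeaf])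
    -- The quarter 10, where x₀⁻ⁿ acts, needs no decay: unitarity and Cauchy-Schwarz suffice.
    have h3 : ‖inner ℂ (preRep RR (xZero ^ n)⁻¹ (preLeaf RR (u ζ))) (preLeaf RR (u ζ))‖ ≤ 1 :=
      (norm_inner_le_norm _ _).trans_eq (by simp [norm_preLeaf, hζ])
    have h4 : ‖inner ℂ (preLeaf RR ζ) (preLeaf RR ζ)‖ ≤ 1 :=
      (norm_inner_le_norm _ _).trans_eq (by simp [norm_preLeaf, hζ])
    rw [hζ, one_mul, one_mul] at h1
    calc _ ≤ (‖ξ‖ * ‖η‖ * ‖inner ℂ ζ (u ζ)‖ ^ n) * (1 * 1) := by gcongr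
      _ = _ := by ring
  · simpa using (tendsto_pow_atTop_nhds_zero_of_lt_one (norm_nonneg _) hu).const_mul (‖ξ‖ * ‖η‖)

/-- The element acting as `g` on the interval `[0, 2⁻ᵏ)`, and as the identity elsewhere. -/
def cornerV (g : ThompsonV) : ℕ → ThompsonV
  | 0 => g
  | k + 1 => pairV (cornerV g k, 1)

theorem cornerV_mem {g : ThompsonV} (hg : g ∈ ⁅ThompsonF, ThompsonF⁆) :
    ∀ k, cornerV g k ∈ ⁅ThompsonF, ThompsonF⁆
  | 0 => hg
  | k + 1 => pairV_one_mem_commutator (cornerV_mem hg k)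

/-- On an elementary join the right half contributes a factor independent of n, so the decay is
inherited from the left half, down to the single leaf [0, 2⁻ᵏ). Bilinearity covers general tensors,
which is why two vectors x and y appear instead of one. -/
theorem tendsto_inner_cornerV (hu : ‖inner ℂ ζ (u ζ)‖ < 1) : ∀ (k : ℕ)
    (x y : TensorPow H (BTree.complete k)), Tendsto (fun n : ℕ => inner ℂ
      (preRep RR (cornerV (innerCommutator (xZero ^ n)) k) (preClass RR (BTree.complete k) x))
        (preClass RR (BTree.complete k) y)) atTop (𝓝 0)
  | 0, x, y => by
    obtain ⟨x, rfl⟩ := leafTensor.symm.surjective x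
    obtain ⟨y, rfl⟩ := leafTensor.symm.surjective y
    exact tendsto_inner_innerCommutator_preLeaf hζ hu x y
  | k + 1, x, y => by
    obtain ⟨x, rfl⟩ := (joinTensor _ _).surjective x
    obtain ⟨y, rfl⟩ := (joinTensor _ _).surjective y
    change Tendsto (fun n : ℕ => inner ℂ
      (preRep RR (pairV (cornerV (innerCommutator (xZero ^ n)) k, 1))
        (preClass RR (.node (BTree.complete k) (BTree.complete k)) (joinTensor _ _ x)))
        (preClass RR (.node (BTree.complete k) (BTree.complete k)) (joinTensor _ _ y))) atTop (𝓝 0)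
    induction x with
    | zero => simp
    | add x x' hx hx' => simpa [inner_add_left] using hx.add hx'
    | tmul a b =>
      induction y with
      | zero => simp
      | add y y' hy hy' => simpa [inner_add_right] using hy.add hy'
      | tmul c d =>
        simp only [← preJoin_preClass, preRep_pairV, inner_preJoin]
        simpa using (tendsto_inner_cornerV hu k a c).mul_const _

theorem exists_tendsto_inner_preRep (hu : ‖inner ℂ ζ (u ζ)‖ < 1) (x : JonesPreSpace RR) :
    ∃ g : ℕ → ThompsonV, (∀ n, g n ∈ ⁅ThompsonF, ThompsonF⁆) ∧
      Tendsto (fun n => inner ℂ (preRep RR (g n) x) x) atTop (𝓝 0) := by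
  obtain ⟨t, ξ, rfl⟩ := exists_preClass RR x
  rw [← preClass_phi RR (t.le_complete le_rfl)]
  exact ⟨_, fun n => cornerV_mem (innerCommutator_mem (pow_mem xZero_mem_thompsonF n)) _,
    tendsto_inner_cornerV hζ hu _ _ _⟩

/-- Approximate ξ by x in the inductive limit. Invariance turns ‖ξ‖² into a coefficient of g at x,
which can be made small, plus errors controlled by ‖ξ - x‖. -/
theorem eq_zero_of_jonesRep_invariant (hu : ‖inner ℂ ζ (u ζ)‖ < 1) (ξ : JonesSpace RR)
    (h : ∀ g ∈ ⁅ThompsonF, ThompsonF⁆, jonesRep RR g ξ = ξ) : ξ = 0 := by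
  -- The sequence in [F, F] depends on x, so its limit is taken with x fixed; the resulting
  -- inequality no longer mentions the sequence.
  have key : ∀ x : JonesPreSpace RR, ‖ξ‖ ^ 2 ≤ ‖ξ - x‖ * (‖ξ‖ + ‖(x : JonesSpace RR)‖) := by
    intro x
    obtain ⟨g, hg, hlim⟩ := exists_tendsto_inner_preRep hζ hu x
    refine le_of_tendsto' (x := atTop) (f := fun n => ‖ξ‖ ^ 2 - ‖inner ℂ (preRep RR (g n) x) x‖) ?_ fun n => ?_
    · simpa using hlim.norm.const_sub (‖ξ‖ ^ 2)
    · have h1 : jonesRep RR (g n) x = (preRep RR (g n) x : JonesPreSpace RR) :=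
        completionMap_coe (preRep RR (g n)) x
      have h2 : inner ℂ ξ ξ = inner ℂ (jonesRep RR (g n) (ξ - x)) ξ +
          inner ℂ (jonesRep RR (g n) x) (ξ - x) + inner ℂ (preRep RR (g n) x) x := by
        rw [← UniformSpace.Completion.inner_coe (preRep RR (g n) x) x, ← h1, map_sub,
          inner_sub_left, inner_sub_right, h _ (hg n)]
        ring
      have h3 : ‖ξ‖ ^ 2 = ‖inner ℂ ξ ξ‖ := by rw [inner_self_eq_norm_sq_to_K]; simp
      have h4 := norm_inner_le_norm (𝕜 := ℂ) (jonesRep RR (g n) (ξ - x)) ξ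
      have h5 := norm_inner_le_norm (𝕜 := ℂ) (jonesRep RR (g n) x) (ξ - x)
      rw [LinearIsometryEquiv.norm_map] at h4 h5
      rw [h3, h2]
      have h6 := norm_add₃_le (a := inner ℂ (jonesRep RR (g n) (ξ - x)) ξ)
        (b := inner ℂ (jonesRep RR (g n) x) (ξ - x)) (c := inner ℂ (preRep RR (g n) x) x)
      linarith
  have h0 : ‖ξ‖ ^ 2 ≤ ‖ξ - ξ‖ * (‖ξ‖ + ‖ξ‖) := by
    -- Both sides are continuous in the approximating vector, so the inequality passes from the
    -- dense subspace to ξ itself, where its right side vanishes.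
    refine UniformSpace.Completion.induction_on (p := fun y : JonesSpace RR =>
      ‖ξ‖ ^ 2 ≤ ‖ξ - y‖ * (‖ξ‖ + ‖y‖)) ξ ?_ key
    exact isClosed_le continuous_const (by fun_prop)
  simpa using h0

end NoInvariantVectors

/-! ### The vectors `ζ_m` -/

theorem zeta_apply (m : ℕ+) (j : ℤ) :
    zeta m j = if j ∈ Finset.Icc (1 : ℤ) (hSeq m) then ((1 / Real.sqrt (hSeq m) : ℝ) : ℂ) else 0 := by
  rw [zeta, lp.coeFn_sum, Finset.sum_apply]
  simp only [lp.single_apply, Pi.single_apply]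
  rw [Finset.sum_ite_eq]

theorem shift_pow_apply (f : EllTwoZ) (k : ℕ) (j : ℤ) : (shift ^ k) f j = f (j - k) := by
  induction k generalizing j with
  | zero => simp
  | succ k ih =>
    rw [pow_succ']
    refine (ih (j - 1)).trans ?_
    exact congrArg f (by push_cast; ring)

theorem hSeq_pos (m : ℕ+) : 0 < hSeq m := by
  have := m.pos
  simp only [hSeq]
  positivity

/-- The shifts are the normalised indicators of {1 + k, …, h + k} and {1 + l, …, h + l}, so their
inner product is 1/h times the number of common points. The truncation `toNat` accounts for disjoint
intervals. -/
theorem inner_shift_pow_zeta (m : ℕ+) (k l : ℕ) :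
    inner ℂ ((shift ^ k) (zeta m)) ((shift ^ l) (zeta m)) =
      (((min (hSeq m + k : ℤ) (hSeq m + l) + 1 - max (1 + k) (1 + l)).toNat / hSeq m : ℝ) : ℂ) := by
  have hpos : (0 : ℝ) < hSeq m := by exact_mod_cast hSeq_pos m
  have h : ∀ j : ℤ, inner ℂ ((shift ^ k) (zeta m) j) ((shift ^ l) (zeta m) j) =
      if j ∈ Finset.Icc (max (1 + k : ℤ) (1 + l)) (min (hSeq m + k) (hSeq m + l)) then
        ((1 / hSeq m : ℝ) : ℂ) else 0 := by
    intro j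
    rw [shift_pow_apply, shift_pow_apply, zeta_apply, zeta_apply]
    have hsq : ((1 / Real.sqrt (hSeq m) : ℝ) : ℂ) * ((1 / Real.sqrt (hSeq m) : ℝ) : ℂ) =
        ((1 / hSeq m : ℝ) : ℂ) := by
      rw [← Complex.ofReal_mul, div_mul_div_comm, one_mul, Real.mul_self_sqrt hpos.le]
    have hmem : j ∈ Finset.Icc (max (1 + k : ℤ) (1 + l)) (min (hSeq m + k) (hSeq m + l)) ↔
        j - k ∈ Finset.Icc (1 : ℤ) (hSeq m) ∧ j - l ∈ Finset.Icc (1 : ℤ) (hSeq m) := by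
      simp only [Finset.mem_Icc]
      omega
    by_cases h1 : j - k ∈ Finset.Icc (1 : ℤ) (hSeq m) <;>
    by_cases h2 : j - l ∈ Finset.Icc (1 : ℤ) (hSeq m)
    · rw [if_pos h1, if_pos h2, if_pos (hmem.2 ⟨h1, h2⟩), ← hsq, RCLike.inner_apply,
        Complex.conj_ofReal]
    all_goals
      rw [if_neg (fun h => by tauto : j ∉ Finset.Icc (max (1 + k : ℤ) (1 + l)) _)]
      simp [*]
  rw [lp.inner_eq_tsum, tsum_congr h, tsum_eq_sum (s := Finset.Icc (max (1 + k : ℤ) (1 + l))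
    (min (hSeq m + k) (hSeq m + l))) fun j hj => if_neg hj,
    Finset.sum_congr rfl fun j hj => if_pos hj, Finset.sum_const, Int.card_Icc]
  push_cast
  simp [div_eq_mul_inv]

/-- A shift by one step loses exactly one of the h points, so the value is (h - 1)/h. -/
theorem norm_inner_zeta_shift_lt_one (m : ℕ+) : ‖inner ℂ (zeta m) (shift (zeta m))‖ < 1 := by
  have h := inner_shift_pow_zeta m 0 1
  rw [pow_zero, pow_one] at h
  change inner ℂ (zeta m) (shift (zeta m)) = _ at h
  have hpos : (0 : ℝ) < hSeq m := by exact_mod_cast hSeq_pos m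
  rw [h, Complex.norm_real, Real.norm_of_nonneg (by positivity), div_lt_one hpos]
  have := hSeq_pos m
  rw [Nat.cast_lt]
  omega

theorem exists_inner_shift_pow_zeta {m : ℕ+} {n k l : ℕ} (hk : k ≤ n) (hl : l ≤ n) :
    ∃ r : ℝ, 0 ≤ r ∧ 1 - n / hSeq m ≤ r ∧
      inner ℂ ((shift ^ k) (zeta m)) ((shift ^ l) (zeta m)) = r := by
  have hpos : (0 : ℝ) < hSeq m := by exact_mod_cast hSeq_pos m
  refine ⟨_, ?_, ?_, inner_shift_pow_zeta m k l⟩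
  · positivity
  · rw [sub_le_iff_le_add, ← add_div, one_le_div hpos, ← Nat.cast_add, Nat.cast_le]
    omega

/-! ### Almost invariant vectors -/

section AlmostInvariant

variable {H : Type*} [NormedAddCommGroup H] [InnerProductSpace ℂ H] (u : H ≃ₗᵢ[ℂ] H) (ζ : H)
  (hζ : ‖ζ‖ = 1)

/-- Each step to a left child raises the exponent of u by one, and each step to a right child resets
it to 0 since that factor is a fresh ζ. The exponent j is arbitrary to let the induction pass to the
left subtree. -/
theorem exists_phiTree_tensorIsometry : ∀ (t : BTree) (j : ℕ), ∃ k : Leaves t → ℕ,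
    (∀ i, k i ≤ j + t.height) ∧ phiTree (tensorIsometry u ζ hζ) t ((u ^ j) ζ) =
      PiTensorProduct.tprod ℂ fun i => (u ^ k i) ζ
  | .leaf, j => ⟨fun _ => j, fun _ => le_rfl, leafTensor_symm_apply _⟩
  | .node l r, j => by
    obtain ⟨a, ha, ha'⟩ := exists_phiTree_tensorIsometry l (j + 1)
    obtain ⟨b, hb, hb'⟩ := exists_phiTree_tensorIsometry r 0
    refine ⟨leavesElim a b, ?_, ?_⟩
    · rintro (i | i)
      · have := ha i
        simp only [BTree.height, leavesElim, Sum.elim_inl]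
        omega
      · have := hb i
        simp only [BTree.height, leavesElim, Sum.elim_inr]
        omega
    · have h : tensorIsometry u ζ hζ ((u ^ j) ζ) = (u ^ (j + 1)) ζ ⊗ₜ (u ^ 0) ζ := by
        rw [pow_succ']; rfl
      simp only [phiTree, LinearMap.comp_apply, LinearEquiv.coe_coe, LinearIsometry.coe_toLinearMap]
      rw [h, TensorProduct.map_tmul, ha', hb', joinTensor_tprod]
      refine congrArg (PiTensorProduct.tprod ℂ) (funext fun i => ?_)
      obtain i | i := i <;> rfl

theorem exists_phi_tensorIsometry : ∀ {s t : BTree}, s ≤ t → ∃ k : Leaves t → ℕ,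
    (∀ i, k i ≤ t.height) ∧ phi (tensorIsometry u ζ hζ) s t (PiTensorProduct.tprod ℂ fun _ => ζ) =
      PiTensorProduct.tprod ℂ fun i => (u ^ k i) ζ
  | .leaf, t, _ => by
    obtain ⟨k, hk, hk'⟩ := exists_phiTree_tensorIsometry u ζ hζ t 0
    refine ⟨k, by simpa using hk, ?_⟩
    rw [← hk', ← leafTensor_symm_apply]
    simp [phi]
  | .node _ _, .leaf, h => h.elim
  | .node l r, .node l' r', h => by
    obtain ⟨a, ha, ha'⟩ := exists_phi_tensorIsometry (s := l) (t := l') h.1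
    obtain ⟨b, hb, hb'⟩ := exists_phi_tensorIsometry (s := r) (t := r') h.2
    refine ⟨leavesElim a b, ?_, ?_⟩
    · rintro (i | i)
      · exact ((ha i).trans (le_max_left _ _)).trans (Nat.le_succ _)
      · exact ((hb i).trans (le_max_right _ _)).trans (Nat.le_succ _)
    · have h : (PiTensorProduct.tprod ℂ fun _ : Leaves (.node l r) => ζ) =
          joinTensor l r (PiTensorProduct.tprod ℂ (fun _ => ζ) ⊗ₜ
            PiTensorProduct.tprod ℂ fun _ => ζ) := by
        rw [joinTensor_tprod]
        refine congrArg (PiTensorProduct.tprod ℂ) (funext fun i => ?_)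
        obtain i | i := i <;> rfl
      rw [h, phi_joinTensor, ha', hb', joinTensor_tprod]
      refine congrArg (PiTensorProduct.tprod ℂ) (funext fun i => ?_)
      obtain i | i := i <;> rfl

end AlmostInvariant

/-- The vector `(t, ζ_m ⊗ ⋯ ⊗ ζ_m)`. -/
def constFraction (m : ℕ+) (t : BTree) : JonesSpace (kazhdanIsometry m) :=
  fraction (kazhdanIsometry m) t (PiTensorProduct.tprod ℂ fun _ => zeta m)

theorem norm_constFraction (m : ℕ+) (t : BTree) : ‖constFraction m t‖ = 1 := by
  have h : inner ℂ (constFraction m t) (constFraction m t) = (1 : ℂ) := by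
    rw [constFraction, inner_fraction, tensorInner_tprod]
    simp [inner_self_eq_norm_sq_to_K, norm_zeta]
  have h' : ‖constFraction m t‖ ^ 2 = 1 := by
    rw [← inner_self_eq_norm_sq (𝕜 := ℂ), h]
    simp
  exact (pow_eq_one_iff_of_nonneg (norm_nonneg _) two_ne_zero).1 h'

/-- Both vectors are refined to the complete tree of depth 2m, where the inner product is a product
of 4ᵐ nonnegative reals, each at least 1 - 8⁻ᵐ. -/
theorem one_sub_le_re_inner_constFraction (m : ℕ+) {s t : BTree} (hs : s.height ≤ 2 * m)
    (ht : t.height ≤ 2 * m) :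
    1 - (1 / 2 : ℝ) ^ (m : ℕ) ≤ (inner ℂ (constFraction m s) (constFraction m t)).re := by
  have hs' := s.le_complete hs
  have ht' := t.le_complete ht
  obtain ⟨k, hk, hk'⟩ := exists_phi_tensorIsometry shift (zeta m) (norm_zeta m) hs'
  obtain ⟨l, hl, hl'⟩ := exists_phi_tensorIsometry shift (zeta m) (norm_zeta m) ht'
  rw [BTree.height_complete] at hk hl
  choose r hr0 hr1 hr2 using fun i => exists_inner_shift_pow_zeta (m := m) (hk i) (hl i)
  rw [constFraction, constFraction, ← fraction_phi _ hs', ← fraction_phi _ ht', inner_fraction,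
    kazhdanIsometry, hk', hl', tensorInner_tprod, Finset.prod_congr rfl fun i _ => hr2 i,
    ← Complex.ofReal_prod, Complex.ofReal_re]
  have hpos : (0 : ℝ) < hSeq m := by exact_mod_cast hSeq_pos m
  have hm : (1 : ℝ) ≤ m := by exact_mod_cast m.pos
  have h8 : (1 : ℝ) ≤ 8 ^ (m : ℕ) := one_le_pow₀ (by norm_num)
  -- The definition of h(m) is tuned for this: the factor 2m cancels the largest possible shift, and
  -- 8ᵐ outgrows the number 4ᵐ of leaves.
  have hh : ((2 * m : ℕ) : ℝ) / hSeq m = (1 / 8) ^ (m : ℕ) := by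
    simp only [hSeq]
    push_cast
    field_simp
    rw [← mul_pow]
    norm_num
  have hle : (1 / 8 : ℝ) ^ (m : ℕ) ≤ 1 := pow_le_one₀ (by norm_num) (by norm_num)
  rw [hh] at hr1
  calc 1 - (1 / 2 : ℝ) ^ (m : ℕ)
      = 1 + ((2 ^ (2 * m : ℕ) : ℕ) : ℝ) * (-(1 / 8) ^ (m : ℕ)) := by
        rw [pow_mul]
        push_cast
        rw [mul_neg, ← mul_pow, ← sub_eq_add_neg]
        norm_num
    -- Bernoulli's inequality; the preceding equality is 4ᵐ · 8⁻ᵐ = 2⁻ᵐ.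
    _ ≤ (1 + -(1 / 8 : ℝ) ^ (m : ℕ)) ^ (2 ^ (2 * m : ℕ)) :=
        one_add_mul_le_pow (by linarith) _
    _ = ∏ _i : Leaves (BTree.complete (2 * m)), (1 - (1 / 8 : ℝ) ^ (m : ℕ)) := by
        rw [Finset.prod_const, Finset.card_univ, BTree.card_leaves_complete, sub_eq_add_neg]
    _ ≤ ∏ i, r i := Finset.prod_le_prod (fun _ _ => by linarith) fun i _ => hr1 i

theorem norm_constFraction_sub_le (m : ℕ+) {s t : BTree} (hs : s.height ≤ 2 * m)
    (ht : t.height ≤ 2 * m) :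
    ‖constFraction m s - constFraction m t‖ ≤ Real.sqrt (2 * (1 / 2) ^ (m : ℕ)) := by
  refine Real.le_sqrt_of_sq_le ?_
  have h := norm_sub_sq (𝕜 := ℂ) (constFraction m s) (constFraction m t)
  have h' := one_sub_le_re_inner_constFraction m hs ht
  rw [norm_constFraction, norm_constFraction, RCLike.re_eq_complex_re] at h
  linarith

/-! ### The direct sum over m and property (T) -/

theorem norm_kazhdanVector (m : ℕ+) : ‖kazhdanVector m‖ = 1 := by
  rw [kazhdanVector, lp.norm_single (by simp)]
  exact norm_constFraction m _

theorem kazhdanRep_single (g : ThompsonV) (m : ℕ+) (x : JonesSpace (kazhdanIsometry m)) :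
    kazhdanRep g (lp.single 2 m x) = lp.single 2 m (jonesRep (kazhdanIsometry m) g x) := by
  refine lp.ext (funext fun i => ?_)
  rw [kazhdanRep, directSumRep_apply]
  obtain rfl | h := eq_or_ne i m
  · rw [lp.single_apply_self, lp.single_apply_self]
  · rw [lp.single_apply_ne _ _ _ h, lp.single_apply_ne _ _ _ h, map_zero]

/-- Once m is at least the heights of a pair (s, t) representing g, the complete tree t_m refines s,
and g replaces t_m by a tree of height at most 2m while keeping the constant tensor ζ_m ⊗ ⋯ ⊗ ζ_m.
-/
theorem norm_kazhdanRep_sub_le (g : ThompsonV) : ∃ M : ℕ, ∀ m : ℕ+, M ≤ m →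
    ‖kazhdanRep g (kazhdanVector m) - kazhdanVector m‖ ≤ Real.sqrt (2 * (1 / 2) ^ (m : ℕ)) := by
  obtain ⟨s, t, σ, hg⟩ := g.2
  refine ⟨max s.height t.height, fun m hm => ?_⟩
  obtain ⟨t', σ', hg', ht'⟩ := hg.refine_height_le
    (s.le_complete ((le_max_left _ _).trans hm))
  rw [BTree.height_complete] at ht'
  have h : jonesRep (kazhdanIsometry m) g (constFraction m (BTree.complete m)) =
      constFraction m t' := by
    rw [constFraction, jonesRep_fraction _ g hg', permTensor_tprod]
    -- Permuting the factors of a constant tensor has no effect.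
    rfl
  rw [kazhdanVector, kazhdanRep_single, ← lp.single_sub, lp.norm_single (by simp)]
  change ‖jonesRep (kazhdanIsometry m) g (constFraction m (BTree.complete m)) -
    constFraction m (BTree.complete m)‖ ≤ _
  rw [h]
  have := (le_max_right _ _).trans hm
  refine norm_constFraction_sub_le m (by omega) ?_
  rw [BTree.height_complete]
  omega

theorem tendsto_kazhdanRep_sub (g : ThompsonV) : Filter.Tendsto
    (fun m : ℕ+ => ‖kazhdanRep g (kazhdanVector m) - kazhdanVector m‖) Filter.atTop (nhds 0) := by
  obtain ⟨M, hM⟩ := norm_kazhdanRep_sub_le g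
  have hcoe : Filter.Tendsto (fun m : ℕ+ => (m : ℕ)) Filter.atTop Filter.atTop :=
    tendsto_PNat_val_atTop_atTop
  refine squeeze_zero' (.of_forall fun _ => norm_nonneg _)
    ((hcoe.eventually_ge_atTop M).mono hM) ?_
  have h := ((tendsto_pow_atTop_nhds_zero_of_lt_one (r := (1 / 2 : ℝ)) (by norm_num)
    (by norm_num)).const_mul 2).sqrt.comp hcoe
  simpa [Function.comp_def] using h

/-- V acts componentwise, so every component of an invariant vector is invariant and the result for
a single m applies. -/
theorem eq_zero_of_kazhdanRep_invariant (ξ : KazhdanSpace)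
    (h : ∀ g ∈ ⁅ThompsonF, ThompsonF⁆, kazhdanRep g ξ = ξ) : ξ = 0 :=
  lp.ext <| funext fun m =>
    eq_zero_of_jonesRep_invariant (norm_zeta m) (norm_inner_zeta_shift_lt_one m) (ξ m)
      fun g hg => (directSumRep_apply _ g ξ m).symm.trans (by rw [← kazhdanRep, h g hg])

/-- Restricting to G preserves almost invariance, as G ⊂ V, while a nonzero G-invariant vector would
be [F, F]-invariant, as [F, F] ⊂ G. -/
theorem not_hasKazhdanPropertyT (G : Subgroup ThompsonV) (hG : ⁅ThompsonF, ThompsonF⁆ ≤ G) :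
    ¬ HasKazhdanPropertyT G := fun hT => by
  obtain ⟨ξ, hne, hξ⟩ := hT KazhdanSpace (kazhdanRep.comp G.subtype) fun Q ε hε => by
    have h : ∀ᶠ m : ℕ+ in Filter.atTop, ∀ g ∈ Q,
        ‖kazhdanRep (g : ThompsonV) (kazhdanVector m) - kazhdanVector m‖ < ε :=
      (Filter.eventually_all_finset Q).2 fun g _ =>
        (tendsto_kazhdanRep_sub g).eventually_lt_const hε
    obtain ⟨m, hm⟩ := h.exists
    exact ⟨kazhdanVector m, norm_kazhdanVector m, hm⟩
  exact hne (eq_zero_of_kazhdanRep_invariant ξ fun g hg => hξ ⟨g, hG hg⟩)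

end JonesThompson

end

theorem mainTheorem1 :
    -- the explicit sequence of unit vectors is almost `V`-invariant
    ((∀ m : ℕ+, ‖kazhdanVector m‖ = 1) ∧
      ∀ g : ThompsonV, Filter.Tendsto
        (fun m : ℕ+ => ‖kazhdanRep g (kazhdanVector m) - kazhdanVector m‖) Filter.atTop (nhds 0)) ∧
    -- there are no nonzero `[F, F]`-invariant vectors
    (∀ ξ : KazhdanSpace, (∀ g ∈ ⁅ThompsonF, ThompsonF⁆, kazhdanRep g ξ = ξ) → ξ = 0) ∧
    -- no group between `[F, F]` and `V` has property (T)
    (∀ G : Subgroup ThompsonV, ⁅ThompsonF, ThompsonF⁆ ≤ G → ¬ HasKazhdanPropertyT G) ∧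
    -- in particular `T` is such a group, and does not have property (T)
    ⁅ThompsonF, ThompsonF⁆ ≤ ThompsonT ∧ ¬ HasKazhdanPropertyT ThompsonT := by
  exact ⟨⟨norm_kazhdanVector, tendsto_kazhdanRep_sub⟩, eq_zero_of_kazhdanRep_invariant,
    not_hasKazhdanPropertyT, commutator_thompsonF_le_thompsonF.trans thompsonF_le_thompsonT,
    not_hasKazhdanPropertyT _ (commutator_thompsonF_le_thompsonF.trans thompsonF_le_thompsonT)⟩
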